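/- Let $\mathcal V=(\mathcal V,\otimes,1_{\mathcal V})$ be a cocomplete closed symmetric monoidal category. All $\mathcal V$-categories are small; $\mathcal V$-$\mathsf{Cat}$ is the 2-category of $\mathcal V$-categories, $\mathcal V$-functors and $\mathcal V$-natural transformations, and $\mathcal C\times\mathcal D$ denotes the $\mathcal V$-category with objects the pairs $(c,d)$ and hom-objects $\mathcal C(c,c')\otimes\mathcal D(d,d')$. Let $\mathcal A$ be a monoidal $\mathcal V$-category, $\mathcal M$ a right and $\mathcal N$ a left $\mathcal A$-module $\mathcal V$-category, with $\mathcal V$-natural associativity isomorphisms $\beta^{\mathcal M}_{m,a,b}\colon (m\triangleleft a)\triangleleft b\cong m\triangleleft(a\otimes b)$, $\beta^{\mathcal N}_{a,b,n}\colon a\triangleright(b\triangleright n)\cong(a\otimes b)\triangleright n$ and unit isomorphisms $\eta^R_m\colon m\triangleleft 1\cong m$, $\eta^L_n\colon 1\triangleright n\cong n$, satisfying the pentagon and triangle identities. **Tambara relative tensor product.** Let $\Omega$ be the $\mathcal V$-graph with vertices the objects of $\mathcal M\times\mathcal N$ and $$\Omega(x,y)=(\mathcal M\times\mathcal N)(x,y)\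 \sqcup\coprod_{a:\ x=(m\triangleleft a,n),\ y=(m,a\triangleright n)}1_{\mathcal V}\ \sqcup\coprod_{a:\ x=(m,a\triangleright n),\ y=(m\triangleleft a,n)}1_{\mathcal V}.$$ The last two families of summands give morphisms $\iota_{m,a,n}\colon(m\triangleleft a,n)\to(m,a\triangleright n)$ and $\iota^{-1}_{m,a,n}\colon(m,a\triangleright n)\to(m\triangleleft a,n)$. Let $\mathrm{Free}(\Omega)$ be the free $\mathcal V$-category on $\Omega$: its hom-object from $A$ to $B$ is the coproduct over all finite sequences $(A,X_1,\dots,X_k,B)$ of $\Omega(A,X_1)\otimes\dots\otimes\Omega(X_k,B)$, together with a summand $1_{\mathcal V}$ if $A=B$, with composition by concatenation. Then $\mathcal M\times_{\mathcal A}\mathcal N:=\mathrm{Free}(\Omega)/\!\sim$ is the $\mathcal V$-category with the same objects obtained by imposing the following relations, where imposing $f_i\sim g_i\colon P_i\to\mathcal C(x_i,y_i)$ $(i\in I)$ on a $\mathcal V$-category $\mathcal C$ means replacing each $\mathcal C(a,b)$ by the coequalizer of the two maps $\coprod_i\mathcal C(a,x_i)\otimes P_i\otimes\mathcal C(y_i,b)\rightrightarrows\mathcal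 C(a,b)$ that insert $f_i$, respectively $g_i$, and compose: * (functoriality) the inclusions $(\mathcal M\times\mathcal N)(x,y)\to\mathrm{Free}(\Omega)(x,y)$ are compatible with composition and identities; * (isomorphism) $\iota^{-1}_{m,a,n}\circ\iota_{m,a,n}\sim\mathrm{id}$ and $\iota_{m,a,n}\circ\iota^{-1}_{m,a,n}\sim\mathrm{id}$; * (naturality) the two maps $\mathcal M(m,m')\otimes\mathcal A(a,a')\otimes\mathcal N(n,n')\to\mathrm{Free}(\Omega)\big((m\triangleleft a,n),(m',a'\triangleright n')\big)$, given by $\triangleleft$ followed by composition with $\iota_{m',a',n'}$, respectively by $\triangleright$ followed by precomposition with $\iota_{m,a,n}$, are identified; * (associators) $(\mathrm{id}_m,\beta^{\mathcal N}_{a,b,n})\circ\iota_{m,a,b\triangleright n}\circ\iota_{m\triangleleft a,b,n}\sim\iota_{m,a\otimes b,n}\circ(\beta^{\mathcal M}_{m,a,b},\mathrm{id}_n)$; * (unitors) $(\mathrm{id}_m,\eta^L_n)\circ\iota_{m,1,n}\sim(\eta^R_m,\mathrm{id}_n)$. **Truncated bar construction.** This is the diagram $$\mathcal M\times\mathcal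 A\times\mathcal A\times\mathcal N\ \overset{G_0,G_1,G_2}{\longrightarrow}\ \mathcal M\times\mathcal A\times\mathcal N\ \overset{F_0,F_1}{\longrightarrow}\ \mathcal M\times\mathcal N$$ with $G_0(m,a,b,n)=(m\triangleleft a,b,n)$, $G_1(m,a,b,n)=(m,a\otimes b,n)$, $G_2(m,a,b,n)=(m,a,b\triangleright n)$, $F_0(m,a,n)=(m\triangleleft a,n)$, $F_1(m,a,n)=(m,a\triangleright n)$ and with the 2-morphisms $\kappa_1=\mathrm{id}\colon F_1G_0\Rightarrow F_0G_2$, $\kappa_2=(\beta^{\mathcal M},\mathrm{id})\colon F_0G_0\Rightarrow F_0G_1$, $\kappa_3=(\mathrm{id},\beta^{\mathcal N})\colon F_1G_2\Rightarrow F_1G_1$. A cocone $\sigma$ with summit $\mathcal E$ consists of $\mathcal V$-functors $\sigma_A,\sigma_B,\sigma_C$ from the three $\mathcal V$-categories of the diagram (in the order displayed) to $\mathcal E$ and $\mathcal V$-natural isomorphisms $\sigma_{G_j}\colon\sigma_A\cong\sigma_BG_j$, $\sigma_{F_i}\colon\sigma_B\cong\sigma_CF_i$ such that, with $\Delta_{ij}=(\sigma_{F_i}G_j)\sigma_{G_j}$,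 one has $\sigma_C\kappa_1=\Delta_{02}\Delta_{10}^{-1}$, $\sigma_C\kappa_2=\Delta_{01}\Delta_{00}^{-1}$ and $\sigma_C\kappa_3=\Delta_{11}\Delta_{12}^{-1}$; a morphism of cocones is a triple of $\mathcal V$-natural transformations compatible with these isomorphisms. A cocone with summit $\mathcal P$ exhibits $\mathcal P$ as the bicolimit of the diagram if, for every $\mathcal E$, composition with it is an equivalence from the category of $\mathcal V$-functors $\mathcal P\to\mathcal E$ to the category of cocones with summit $\mathcal E$. **Theorem.** $\mathcal M\times_{\mathcal A}\mathcal N$ is the summit of a cocone that exhibits it as the bicolimit of the truncated bar construction. Hence there is an equivalence of $\mathcal V$-categories $\mathcal M\times_{\mathcal A}\mathcal N\simeq\mathcal M\otimes_{\mathcal A}\mathcal N$ for every bicolimit $\mathcal M\otimes_{\mathcal A}\mathcal N$ of the truncated bar construction. -/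

import Mathlib

open CategoryTheory MonoidalCategory Limits

universe u v

namespace VEnr

section Basics

variable {V : Type v} [Category.{u} V] [MonoidalCategory V]
variable {B C D E : Type u} [EnrichedCategory V B] [EnrichedCategory V C] [EnrichedCategory V D]
  [EnrichedCategory V E]

variable (V) in
/-- Morphisms `X ⟶ Y` of the underlying ordinary category, i.e. morphisms `𝟙_ V ⟶ C(X, Y)`. -/
abbrev UHom (X Y : C) : Type u := ForgetEnrichment.of V X ⟶ ForgetEnrichment.of V Y

/-- Regard a morphism `𝟙_ V ⟶ C(X, Y)` as a morphism of the underlying category. -/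
abbrev uOf {X Y : C} (f : 𝟙_ V ⟶ (X ⟶[V] Y)) : UHom V X Y := f

/-- Regard a morphism of the underlying category as a morphism `𝟙_ V ⟶ C(X, Y)`. -/
abbrev uTo {X Y : C} (f : UHom V X Y) : 𝟙_ V ⟶ (X ⟶[V] Y) := f

/-- The identity of `X` in the underlying category. -/
abbrev uId (X : C) : UHom V X X := 𝟙 (ForgetEnrichment.of V X)

lemma uTo_id (X : C) : uTo (uId (V := V) X) = eId V X := ForgetEnrichment.homTo_id V _

lemma uTo_comp {X Y Z : C} (f : UHom V X Y) (g : UHom V Y Z) :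
    uTo (X := X) (Y := Z) (f ≫ g) = (λ_ (𝟙_ V)).inv ≫ (uTo f ⊗ₘ uTo g) ≫ eComp V X Y Z := by
  exact (ForgetEnrichment.homTo_comp V f g).trans (Category.assoc _ _ _)

/-- Precomposition `C(Y, Z) ⟶ C(X, Z)` with `f : X ⟶ Y`. -/
def precomp {X Y : C} (f : UHom V X Y) (Z : C) : (Y ⟶[V] Z) ⟶ (X ⟶[V] Z) :=
  (λ_ (Y ⟶[V] Z)).inv ≫ uTo f ▷ (Y ⟶[V] Z) ≫ eComp V X Y Z

/-- Postcomposition `C(X, Y) ⟶ C(X, Z)` with `g : Y ⟶ Z`. -/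
def postcomp (X : C) {Y Z : C} (g : UHom V Y Z) : (X ⟶[V] Y) ⟶ (X ⟶[V] Z) :=
  (ρ_ (X ⟶[V] Y)).inv ≫ (X ⟶[V] Y) ◁ uTo g ≫ eComp V X Y Z

lemma precomp_id (X Z : C) : precomp (uId (V := V) X) Z = 𝟙 _ := by
  unfold precomp; rw [uTo_id]; exact e_id_comp V X Z

lemma postcomp_id (X Z : C) : postcomp X (uId (V := V) Z) = 𝟙 _ := by
  unfold postcomp; rw [uTo_id]; exact e_comp_id V X Z

lemma precomp_comp {W X Y : C} (f : UHom V W X) (g : UHom V X Y) (Z : C) :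
    precomp (X := W) (Y := Y) (f ≫ g) Z = precomp g Z ≫ precomp f Z := by
  unfold precomp
  rw [uTo_comp]
  simp only [comp_whiskerRight, Category.assoc]
  rw [← e_assoc' V W X Y Z]
  simp only [MonoidalCategory.tensorHom_def, comp_whiskerRight, Category.assoc, whisker_assoc,
    leftUnitor_inv_naturality_assoc]
  simp only [whisker_exchange_assoc]
  monoidal

lemma postcomp_comp (W : C) {X Y Z : C} (f : UHom V X Y) (g : UHom V Y Z) :
    postcomp W (Y := X) (Z := Z) (f ≫ g) = postcomp W f ≫ postcomp W g := by
  unfold postcomp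
  rw [uTo_comp]
  simp only [MonoidalCategory.whiskerLeft_comp, Category.assoc]
  rw [← e_assoc V W X Y Z]
  simp only [MonoidalCategory.tensorHom_def, MonoidalCategory.whiskerLeft_comp, Category.assoc]
  rw [rightUnitor_inv_naturality_assoc (eComp V W X Y), ← whisker_exchange_assoc]
  monoidal

lemma precomp_postcomp {W X Y Z : C} (f : UHom V W X) (g : UHom V Y Z) :
    precomp f Y ≫ postcomp W g = postcomp X g ≫ precomp f Z := by
  unfold precomp postcomp
  simp only [Category.assoc]
  rw [rightUnitor_inv_naturality_assoc (eComp V W X Y),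
    leftUnitor_inv_naturality_assoc (eComp V X Y Z), ← whisker_exchange_assoc,
    whisker_exchange_assoc (uTo f) (eComp V X Y Z), ← e_assoc' V W X Y Z,
    rightUnitor_inv_naturality_assoc (uTo f ▷ (X ⟶[V] Y)), ← whisker_exchange_assoc]
  monoidal

lemma uTo_postcomp {X Y Z : C} (f : UHom V X Y) (g : UHom V Y Z) :
    uTo f ≫ postcomp X g = uTo (X := X) (Y := Z) (f ≫ g) := by
  rw [uTo_comp]; unfold postcomp
  rw [rightUnitor_inv_naturality_assoc, MonoidalCategory.tensorHom_def]
  simp [unitors_inv_equal]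

lemma uTo_precomp {X Y Z : C} (f : UHom V X Y) (g : UHom V Y Z) :
    uTo g ≫ precomp f Z = uTo (X := X) (Y := Z) (f ≫ g) := by
  rw [uTo_comp]; unfold precomp
  rw [leftUnitor_inv_naturality_assoc, MonoidalCategory.tensorHom_def']
  simp


/-! ### `V`-functors and `V`-natural transformations -/

variable (V) in
/-- `V`-functors. This is a copy of `EnrichedFunctor V C D`, introduced because the morphisms
of `V`-functors considered here are the `V`-natural transformations, which are natural with
respect to the hom-objects and not only with respect to the underlying ordinary categories. -/
structure VFun (C D : Type u) [EnrichedCategory V C] [EnrichedCategory V D] extends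
  EnrichedFunctor V C D

namespace VFun

variable (V) in
/-- The identity `V`-functor. -/
abbrev id (C : Type u) [EnrichedCategory V C] : VFun V C C where
  obj X := X
  map X Y := 𝟙 _

/-- Composition of `V`-functors, in diagrammatic order. -/
abbrev comp (F : VFun V C D) (G : VFun V D E) : VFun V C E where
  obj X := G.obj (F.obj X)
  map X Y := F.map X Y ≫ G.map (F.obj X) (F.obj Y)

/-- The action of a `V`-functor on morphisms of the underlying categories. -/
def mapHom (F : VFun V C D) {X Y : C} (f : UHom V X Y) : UHom V (F.obj X) (F.obj Y) :=
  uOf (uTo f ≫ F.map X Y)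

lemma mapHom_id (F : VFun V C D) (X : C) : F.mapHom (uId (V := V) X) = uId (F.obj X) := by
  show uTo (uId X) ≫ F.map X X = uTo (uId (V := V) (F.obj X))
  rw [uTo_id, uTo_id]; exact F.map_id X

lemma mapHom_comp (F : VFun V C D) {X Y Z : C} (f : UHom V X Y) (g : UHom V Y Z) :
    F.mapHom (X := X) (Y := Z) (f ≫ g) = F.mapHom f ≫ F.mapHom g := by
  show uTo (X := X) (Y := Z) (f ≫ g) ≫ F.map X Z =
    uTo (X := F.obj X) (Y := F.obj Z) (F.mapHom f ≫ F.mapHom g)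
  rw [uTo_comp, uTo_comp]
  simp only [Category.assoc]
  rw [F.map_comp X Y Z]
  simp only [mapHom, ← MonoidalCategory.tensorHom_comp_tensorHom, Category.assoc]

lemma comp_mapHom (F : VFun V C D) (G : VFun V D E) {X Y : C} (f : UHom V X Y) :
    (F.comp G).mapHom f = G.mapHom (F.mapHom f) := (Category.assoc _ _ _).symm

lemma map_precomp (F : VFun V C D) {X Y : C} (f : UHom V X Y) (Z : C) :
    F.map Y Z ≫ precomp (F.mapHom f) (F.obj Z) = precomp f Z ≫ F.map X Z := by
  unfold precomp
  simp only [Category.assoc]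
  rw [F.map_comp X Y Z]
  rw [leftUnitor_inv_naturality_assoc, whisker_exchange_assoc, MonoidalCategory.tensorHom_def]
  simp only [mapHom, comp_whiskerRight, Category.assoc]

lemma map_postcomp (F : VFun V C D) (X : C) {Y Z : C} (g : UHom V Y Z) :
    F.map X Y ≫ postcomp (F.obj X) (F.mapHom g) = postcomp X g ≫ F.map X Z := by
  unfold postcomp
  simp only [Category.assoc]
  rw [F.map_comp X Y Z]
  rw [rightUnitor_inv_naturality_assoc, ← whisker_exchange_assoc, MonoidalCategory.tensorHom_def']
  simp [mapHom]

end VFun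

/-- A `V`-natural transformation `F ⟶ G`: components `𝟙_ V ⟶ D(F X, G X)` such that
`C(X, Y) ⟶ D(F X, F Y) ⟶ D(F X, G Y)` and `C(X, Y) ⟶ D(G X, G Y) ⟶ D(F X, G Y)` agree. -/
@[ext]
structure VNatTrans (F G : VFun V C D) where
  /-- The components. -/
  app : ∀ X : C, UHom V (F.obj X) (G.obj X)
  naturality : ∀ X Y : C, F.map X Y ≫ postcomp (F.obj X) (app Y) =
    G.map X Y ≫ precomp (app X) (G.obj Y)

/-- `V`-naturality with respect to morphisms of the underlying category. -/
lemma VNatTrans.naturality_hom {F G : VFun V C D} (α : VNatTrans F G) {X Y : C} (f : UHom V X Y) :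
    F.mapHom f ≫ α.app Y = α.app X ≫ G.mapHom f := by
  have h := congrArg (fun k => uTo f ≫ k) (α.naturality X Y)
  simp only [← Category.assoc] at h
  exact (uTo_postcomp (F.mapHom f) (α.app Y)).symm.trans
    (h.trans (uTo_precomp (α.app X) (G.mapHom f)))

lemma VNatTrans.naturality_assoc {F G : VFun V C D} (α : VNatTrans F G) (X Y : C) {Z : V}
    (h : (F.obj X ⟶[V] G.obj Y) ⟶ Z) : F.map X Y ≫ postcomp (F.obj X) (α.app Y) ≫ h =
      G.map X Y ≫ precomp (α.app X) (G.obj Y) ≫ h := by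
  rw [← Category.assoc, α.naturality, Category.assoc]

/-- The category of `V`-functors `C ⟶ D` and `V`-natural transformations. -/
instance : Category (VFun V C D) where
  Hom F G := VNatTrans F G
  id F := ⟨fun X => uId (F.obj X), fun X Y => by rw [precomp_id, postcomp_id]⟩
  comp {F G H} α β := ⟨fun X => α.app X ≫ β.app X, fun X Y => by
    erw [precomp_comp, postcomp_comp, ← Category.assoc, α.naturality, Category.assoc,
      precomp_postcomp, ← Category.assoc, β.naturality, Category.assoc]⟩
  id_comp α := VNatTrans.ext (funext fun X => Category.id_comp (α.app X))
  comp_id α := VNatTrans.ext (funext fun X => Category.comp_id (α.app X))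
  assoc α β γ := VNatTrans.ext (funext fun X => Category.assoc (α.app X) (β.app X) (γ.app X))

/-- The component at `X` of a morphism of `V`-functors. -/
abbrev natApp {F G : VFun V C D} (α : F ⟶ G) (X : C) : UHom V (F.obj X) (G.obj X) :=
  VNatTrans.app α X

lemma nat_ext {F G : VFun V C D} {α β : F ⟶ G} (h : ∀ X, natApp α X = natApp β X) : α = β :=
  VNatTrans.ext (funext h)

@[simp] lemma natApp_id (F : VFun V C D) (X : C) : natApp (𝟙 F) X = uId (F.obj X) := rfl

@[simp] lemma natApp_comp {F G H : VFun V C D} (α : F ⟶ G) (β : G ⟶ H) (X : C) :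
    natApp (α ≫ β) X = natApp α X ≫ natApp β X := rfl

namespace VFun

/-- Whiskering by a `V`-functor on the right. -/
def whiskerR {F G : VFun V C D} (α : F ⟶ G) (H : VFun V D E) : F.comp H ⟶ G.comp H :=
  VNatTrans.mk (fun X => H.mapHom (natApp α X)) (fun X Y => by
    rw [Category.assoc, Category.assoc, map_postcomp, map_precomp]
    exact α.naturality_assoc X Y _)

/-- Whiskering by a `V`-functor on the left. -/
def whiskerL (H : VFun V B C) {F G : VFun V C D} (α : F ⟶ G) : H.comp F ⟶ H.comp G :=
  VNatTrans.mk (fun X => natApp α (H.obj X)) (fun X Y => by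
    rw [Category.assoc, Category.assoc]
    exact congrArg (_ ≫ ·) (α.naturality (H.obj X) (H.obj Y)))

end VFun

namespace VFun

lemma whiskerL_id (H : VFun V B C) (F : VFun V C D) : whiskerL H (𝟙 F) = 𝟙 (H.comp F) := rfl

lemma whiskerL_comp (H : VFun V B C) {F G K : VFun V C D} (α : F ⟶ G) (β : G ⟶ K) :
    whiskerL H (α ≫ β) = whiskerL H α ≫ whiskerL H β := rfl

/-- From a `V`-natural isomorphism `F ≅ K ∘ G`, the isomorphism `H ∘ F ≅ (H ∘ K) ∘ G` with
components `H (α_X)`. -/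
def postIso {F : VFun V B D} {G : VFun V B C} {K : VFun V C D} (α : F ≅ G.comp K)
    (H : VFun V D E) : F.comp H ≅ G.comp (K.comp H) where
  hom := VNatTrans.mk (fun X => H.mapHom (natApp α.hom X)) (fun X Y => by
    have e : (G.comp (K.comp H)).map X Y = ((G.comp K).comp H).map X Y :=
      (Category.assoc _ _ _).symm
    rw [e]
    exact (whiskerR α.hom H).naturality X Y)
  inv := VNatTrans.mk (fun X => H.mapHom (natApp α.inv X)) (fun X Y => by
    have e : (G.comp (K.comp H)).map X Y = ((G.comp K).comp H).map X Y :=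
      (Category.assoc _ _ _).symm
    rw [e]
    exact (whiskerR α.inv H).naturality X Y)
  hom_inv_id := nat_ext fun X => by
    have h := congrArg (fun β => natApp β X) α.hom_inv_id
    exact (H.mapHom_comp _ _).symm.trans ((congrArg H.mapHom h).trans (H.mapHom_id _))
  inv_hom_id := nat_ext fun X => by
    have h := congrArg (fun β => natApp β X) α.inv_hom_id
    exact (H.mapHom_comp _ _).symm.trans ((congrArg H.mapHom h).trans (H.mapHom_id _))

end VFun

variable (V) in
/-- Two `V`-categories are equivalent if there are `V`-functors in both directions whose two
composites are isomorphic to the identities (by `V`-natural isomorphisms). -/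
def VEquivalent (C D : Type u) [EnrichedCategory V C] [EnrichedCategory V D] : Prop :=
  ∃ (F : VFun V C D) (G : VFun V D C),
    Nonempty (F.comp G ≅ VFun.id V C) ∧ Nonempty (G.comp F ≅ VFun.id V D)

lemma eId_whisker_comp (X Y : C) :
    eId V X ▷ (X ⟶[V] Y) ≫ eComp V X X Y = (λ_ (X ⟶[V] Y)).hom := by
  rw [← cancel_epi (λ_ (X ⟶[V] Y)).inv, e_id_comp, Iso.inv_hom_id]

lemma whisker_eId_comp (X Y : C) :
    (X ⟶[V] Y) ◁ eId V Y ≫ eComp V X Y Y = (ρ_ (X ⟶[V] Y)).hom := by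
  rw [← cancel_epi (ρ_ (X ⟶[V] Y)).inv, e_comp_id, Iso.inv_hom_id]

lemma eId_eId_comp (X : C) : (eId V X ⊗ₘ eId V X) ≫ eComp V X X X =
    (λ_ (𝟙_ V)).hom ≫ eId V X := by
  rw [MonoidalCategory.tensorHom_def', Category.assoc, eId_whisker_comp, leftUnitor_naturality]

lemma tensor_unit_assoc_aux {P Q R : V} (f : 𝟙_ V ⟶ P) (g : 𝟙_ V ⟶ Q) (h : 𝟙_ V ⟶ R) :
    ((λ_ (𝟙_ V)).inv ≫ (f ⊗ₘ ((λ_ (𝟙_ V)).inv ≫ (g ⊗ₘ h)))) ≫ (α_ P Q R).inv =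
      (λ_ (𝟙_ V)).inv ≫ (((λ_ (𝟙_ V)).inv ≫ (f ⊗ₘ g)) ⊗ₘ h) := by
  have e : (f ⊗ₘ ((λ_ (𝟙_ V)).inv ≫ (g ⊗ₘ h))) =
      𝟙_ V ◁ (λ_ (𝟙_ V)).inv ≫ (f ⊗ₘ (g ⊗ₘ h)) := by
    rw [← id_tensorHom, MonoidalCategory.tensorHom_comp_tensorHom, Category.id_comp]
  have e' : (((λ_ (𝟙_ V)).inv ≫ (f ⊗ₘ g)) ⊗ₘ h) =
      (λ_ (𝟙_ V)).inv ▷ 𝟙_ V ≫ ((f ⊗ₘ g) ⊗ₘ h) := by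
    rw [← tensorHom_id, MonoidalCategory.tensorHom_comp_tensorHom, Category.id_comp]
  rw [e, e', Category.assoc, Category.assoc, associator_inv_naturality, ← Category.assoc,
    ← Category.assoc, ← Category.assoc]
  congr 1
  monoidal

end Basics

/-! ### The tensor product of `V`-categories -/

section Product

variable {V : Type v} [Category.{u} V] [MonoidalCategory V] [SymmetricCategory V]
variable {B C D E C' D' : Type u} [EnrichedCategory V B] [EnrichedCategory V C]
  [EnrichedCategory V D] [EnrichedCategory V E] [EnrichedCategory V C'] [EnrichedCategory V D']

lemma tensor_pre_aux {P Q R R' S S' : V} (f : 𝟙_ V ⟶ P) (g : 𝟙_ V ⟶ Q) (c : P ⊗ R ⟶ S)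
    (c' : Q ⊗ R' ⟶ S') :
    (λ_ (R ⊗ R')).inv ≫ ((λ_ (𝟙_ V)).inv ≫ (f ⊗ₘ g)) ▷ (R ⊗ R') ≫ tensorμ P Q R R' ≫ (c ⊗ₘ c') =
      (((λ_ R).inv ≫ f ▷ R ≫ c) ⊗ₘ ((λ_ R').inv ≫ g ▷ R' ≫ c')) := by
  rw [comp_whiskerRight, Category.assoc, tensorμ_natural_left_assoc,
    MonoidalCategory.tensorHom_comp_tensorHom, ← MonoidalCategory.tensorHom_comp_tensorHom
      (λ_ _).inv, ← cancel_epi (λ_ _).hom, Iso.hom_inv_id_assoc, tensor_left_unitality_assoc,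
    MonoidalCategory.tensorHom_comp_tensorHom_assoc, Iso.hom_inv_id, Iso.hom_inv_id]
  simp

lemma tensor_post_aux {P Q R R' S S' : V} (f : 𝟙_ V ⟶ P) (g : 𝟙_ V ⟶ Q) (c : R ⊗ P ⟶ S)
    (c' : R' ⊗ Q ⟶ S') :
    (ρ_ (R ⊗ R')).inv ≫ (R ⊗ R') ◁ ((λ_ (𝟙_ V)).inv ≫ (f ⊗ₘ g)) ≫ tensorμ R R' P Q ≫ (c ⊗ₘ c') =
      (((ρ_ R).inv ≫ R ◁ f ≫ c) ⊗ₘ ((ρ_ R').inv ≫ R' ◁ g ≫ c')) := by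
  rw [MonoidalCategory.whiskerLeft_comp, Category.assoc, tensorμ_natural_right_assoc,
    MonoidalCategory.tensorHom_comp_tensorHom, ← MonoidalCategory.tensorHom_comp_tensorHom
      (ρ_ _).inv, ← cancel_epi (ρ_ _).hom, Iso.hom_inv_id_assoc, tensor_right_unitality_assoc,
    MonoidalCategory.tensorHom_comp_tensorHom_assoc, Iso.hom_inv_id, Iso.hom_inv_id]
  simp

lemma tensor_assoc_aux {X₁ X₂ X₃ Y₁ Y₂ Y₃ Z₁ Z₂ Z₃ : V} (c₁ : X₁ ⊗ Y₁ ⟶ Z₁)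
    (c₂ : X₂ ⊗ Y₂ ⟶ Z₂) (c₃ : X₃ ⊗ Y₃ ⟶ Z₃) :
    (tensorμ X₁ (X₂ ⊗ X₃) Y₁ (Y₂ ⊗ Y₃) ≫ (c₁ ⊗ₘ (tensorμ X₂ X₃ Y₂ Y₃ ≫ (c₂ ⊗ₘ c₃)))) ≫
        (α_ Z₁ Z₂ Z₃).inv =
      ((α_ X₁ X₂ X₃).inv ⊗ₘ (α_ Y₁ Y₂ Y₃).inv) ≫
        tensorμ (X₁ ⊗ X₂) X₃ (Y₁ ⊗ Y₂) Y₃ ≫ ((tensorμ X₁ X₂ Y₁ Y₂ ≫ (c₁ ⊗ₘ c₂)) ⊗ₘ c₃) := by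
  have h := associator_monoidal X₁ X₂ X₃ Y₁ Y₂ Y₃
  have e : (c₁ ⊗ₘ (tensorμ X₂ X₃ Y₂ Y₃ ≫ (c₂ ⊗ₘ c₃))) =
      (X₁ ⊗ Y₁) ◁ tensorμ X₂ X₃ Y₂ Y₃ ≫ (c₁ ⊗ₘ c₂ ⊗ₘ c₃) := by
    rw [← id_tensorHom, MonoidalCategory.tensorHom_comp_tensorHom, Category.id_comp]
  have e' : ((tensorμ X₁ X₂ Y₁ Y₂ ≫ (c₁ ⊗ₘ c₂)) ⊗ₘ c₃) =
      tensorμ X₁ X₂ Y₁ Y₂ ▷ (X₃ ⊗ Y₃) ≫ ((c₁ ⊗ₘ c₂) ⊗ₘ c₃) := by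
    rw [← tensorHom_id, MonoidalCategory.tensorHom_comp_tensorHom, Category.id_comp]
  rw [e, e', Category.assoc, Category.assoc, associator_inv_naturality]
  rw [← cancel_epi ((α_ X₁ X₂ X₃).hom ⊗ₘ (α_ Y₁ Y₂ Y₃).hom)]
  rw [MonoidalCategory.tensorHom_comp_tensorHom_assoc, Iso.hom_inv_id, Iso.hom_inv_id]
  rw [← reassoc_of% h]
  simp

lemma tensor_insL_aux {X Y Z P Q R : V} (e : 𝟙_ V ⟶ P) (e' : 𝟙_ V ⟶ Q) (e'' : 𝟙_ V ⟶ R)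
    (c : P ⊗ Q ⟶ R) (d : X ⊗ Y ⟶ Z) (h : (e ⊗ₘ e') ≫ c = (λ_ (𝟙_ V)).hom ≫ e'') :
    d ≫ (λ_ Z).inv ≫ e'' ▷ Z = (((λ_ X).inv ≫ e ▷ X) ⊗ₘ ((λ_ Y).inv ≫ e' ▷ Y)) ≫
      tensorμ P X Q Y ≫ (c ⊗ₘ d) := by
  have h' := leftUnitor_monoidal X Y
  have h₁ : tensorμ (𝟙_ V) X (𝟙_ V) Y =
      ((λ_ X).hom ⊗ₘ (λ_ Y).hom) ≫ (λ_ (X ⊗ Y)).inv ≫ (λ_ (𝟙_ V)).inv ▷ (X ⊗ Y) := by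
    rw [h']; simp
  rw [← tensorHom_id e X, ← tensorHom_id e' Y, ← MonoidalCategory.tensorHom_comp_tensorHom, Category.assoc,
    tensorμ_natural_assoc, MonoidalCategory.tensorHom_comp_tensorHom, h, h₁]
  simp only [Category.assoc, MonoidalCategory.tensorHom_comp_tensorHom_assoc, Iso.inv_hom_id]
  simp [MonoidalCategory.tensorHom_def']

lemma tensor_insR_aux {X Y Z P Q R : V} (e : 𝟙_ V ⟶ P) (e' : 𝟙_ V ⟶ Q) (e'' : 𝟙_ V ⟶ R)
    (c : P ⊗ Q ⟶ R) (d : X ⊗ Y ⟶ Z) (h : (e ⊗ₘ e') ≫ c = (λ_ (𝟙_ V)).hom ≫ e'') :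
    d ≫ (ρ_ Z).inv ≫ Z ◁ e'' = (((ρ_ X).inv ≫ X ◁ e) ⊗ₘ ((ρ_ Y).inv ≫ Y ◁ e')) ≫
      tensorμ X P Y Q ≫ (d ⊗ₘ c) := by
  have h' := rightUnitor_monoidal X Y
  have h₁ : tensorμ X (𝟙_ V) Y (𝟙_ V) =
      ((ρ_ X).hom ⊗ₘ (ρ_ Y).hom) ≫ (ρ_ (X ⊗ Y)).inv ≫ (X ⊗ Y) ◁ (λ_ (𝟙_ V)).inv := by
    rw [h']; simp
  rw [← id_tensorHom X e, ← id_tensorHom Y e', ← MonoidalCategory.tensorHom_comp_tensorHom, Category.assoc,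
    tensorμ_natural_assoc, MonoidalCategory.tensorHom_comp_tensorHom, h, h₁]
  simp only [Category.assoc, MonoidalCategory.tensorHom_comp_tensorHom_assoc, Iso.inv_hom_id]
  simp only [MonoidalCategory.id_tensorHom_id, Category.id_comp]
  rw [MonoidalCategory.tensorHom_def', MonoidalCategory.whiskerLeft_comp, Category.assoc,
    MonoidalCategory.whiskerLeft_inv_hom_assoc, whisker_exchange,
    ← rightUnitor_inv_naturality_assoc]

/-- The (naive) tensor product of two `V`-categories: objects are pairs of objects, the
hom-objects are `C(c, c') ⊗ D(d, d')`, and the composition uses the symmetry of `V`. -/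
instance prodEnriched (C D : Type u) [EnrichedCategory V C] [EnrichedCategory V D] :
    EnrichedCategory V (C × D) where
  Hom X Y := (X.1 ⟶[V] Y.1) ⊗ (X.2 ⟶[V] Y.2)
  id X := (λ_ (𝟙_ V)).inv ≫ (eId V X.1 ⊗ₘ eId V X.2)
  comp X Y Z := tensorμ (X.1 ⟶[V] Y.1) (X.2 ⟶[V] Y.2) (Y.1 ⟶[V] Z.1) (Y.2 ⟶[V] Z.2) ≫
    (eComp V X.1 Y.1 Z.1 ⊗ₘ eComp V X.2 Y.2 Z.2)
  id_comp X Y := by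
    rw [comp_whiskerRight, Category.assoc, tensorμ_natural_left_assoc,
      MonoidalCategory.tensorHom_comp_tensorHom, eId_whisker_comp, eId_whisker_comp,
      ← tensor_left_unitality, Iso.inv_hom_id]
  comp_id X Y := by
    rw [MonoidalCategory.whiskerLeft_comp, Category.assoc, tensorμ_natural_right_assoc,
      MonoidalCategory.tensorHom_comp_tensorHom, whisker_eId_comp, whisker_eId_comp,
      ← tensor_right_unitality, Iso.inv_hom_id]
  assoc W X Y Z := by
    rw [comp_whiskerRight, MonoidalCategory.whiskerLeft_comp, Category.assoc, Category.assoc,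
      tensorμ_natural_left_assoc, tensorμ_natural_right_assoc,
      MonoidalCategory.tensorHom_comp_tensorHom, MonoidalCategory.tensorHom_comp_tensorHom,
      ← e_assoc' V, ← e_assoc' V, ← MonoidalCategory.tensorHom_comp_tensorHom,
      tensor_associativity_assoc, Iso.inv_hom_id_assoc]

lemma prod_eId (X : C × D) :
    eId V X = (λ_ (𝟙_ V)).inv ≫ (eId V X.1 ⊗ₘ eId V X.2) := rfl

lemma prod_eComp (X Y Z : C × D) :
    eComp V X Y Z = tensorμ (X.1 ⟶[V] Y.1) (X.2 ⟶[V] Y.2) (Y.1 ⟶[V] Z.1) (Y.2 ⟶[V] Z.2) ≫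
      (eComp V X.1 Y.1 Z.1 ⊗ₘ eComp V X.2 Y.2 Z.2) := rfl

/-- The morphism `(X, Y) ⟶ (X', Y')` of the underlying category of `C × D` given by
`f : X ⟶ X'` and `g : Y ⟶ Y'`. -/
def pairHom {X X' : C} {Y Y' : D} (f : UHom V X X') (g : UHom V Y Y') :
    UHom V (X, Y) (X', Y') :=
  uOf (C := C × D) (X := (X, Y)) (Y := (X', Y')) ((λ_ (𝟙_ V)).inv ≫ (uTo f ⊗ₘ uTo g))

lemma uTo_pairHom {X X' : C} {Y Y' : D} (f : UHom V X X') (g : UHom V Y Y') :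
    uTo (X := (X, Y)) (Y := (X', Y')) (pairHom f g) = (λ_ (𝟙_ V)).inv ≫ (uTo f ⊗ₘ uTo g) := rfl

lemma pairHom_id (X : C) (Y : D) :
    pairHom (uId (V := V) X) (uId (V := V) Y) = uId (V := V) (X, Y) := by
  show _ = uTo (uId (V := V) (X, Y))
  rw [uTo_id, prod_eId, ← uTo_id, ← uTo_id]; rfl

lemma precomp_pairHom {X X' : C} {Y Y' : D} (f : UHom V X X') (g : UHom V Y Y') (Z : C × D) :
    precomp (pairHom f g) Z = (precomp f Z.1 ⊗ₘ precomp g Z.2) := by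
  exact tensor_pre_aux _ _ _ _

lemma postcomp_pairHom (W : C × D) {X X' : C} {Y Y' : D} (f : UHom V X X') (g : UHom V Y Y') :
    postcomp W (pairHom f g) = (postcomp W.1 f ⊗ₘ postcomp W.2 g) := by
  exact tensor_post_aux _ _ _ _

lemma pairHom_comp {X X' X'' : C} {Y Y' Y'' : D} (f : UHom V X X') (f' : UHom V X' X'')
    (g : UHom V Y Y') (g' : UHom V Y' Y'') :
    pairHom (X := X) (X' := X'') (Y := Y) (Y' := Y'') (f ≫ f') (g ≫ g') =
      pairHom f g ≫ pairHom f' g' := by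
  refine Eq.trans ?_ (uTo_postcomp (pairHom f g) (pairHom f' g'))
  rw [postcomp_pairHom, uTo_pairHom, Category.assoc, MonoidalCategory.tensorHom_comp_tensorHom]
  dsimp only
  rw [uTo_postcomp, uTo_postcomp]
  rfl

namespace VFun

/-- The tensor product of two `V`-functors. -/
abbrev prod (F : VFun V C C') (G : VFun V D D') : VFun V (C × D) (C' × D') where
  obj X := (F.obj X.1, G.obj X.2)
  map X Y := F.map X.1 Y.1 ⊗ₘ G.map X.2 Y.2
  map_id X := by
    rw [prod_eId, prod_eId, Category.assoc, MonoidalCategory.tensorHom_comp_tensorHom, F.map_id,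
      G.map_id]
  map_comp X Y Z := by
    rw [prod_eComp, prod_eComp, Category.assoc, MonoidalCategory.tensorHom_comp_tensorHom,
      F.map_comp, G.map_comp, tensorμ_natural_assoc, MonoidalCategory.tensorHom_comp_tensorHom]

variable (V) in
/-- The reassociation `V`-functor `C × (D × E) ⟶ (C × D) × E`. -/
abbrev assocInv (C D E : Type u) [EnrichedCategory V C] [EnrichedCategory V D]
    [EnrichedCategory V E] : VFun V (C × D × E) ((C × D) × E) where
  obj X := ((X.1, X.2.1), X.2.2)
  map X Y := (α_ (X.1 ⟶[V] Y.1) (X.2.1 ⟶[V] Y.2.1) (X.2.2 ⟶[V] Y.2.2)).inv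
  map_id X := by
    simp only [prod_eId]
    exact tensor_unit_assoc_aux _ _ _
  map_comp X Y Z := tensor_assoc_aux _ _ _

variable (D) in
/-- The `V`-functor `D ⟶ C × D`, `d ↦ (c, d)`. -/
abbrev insL (c : C) : VFun V D (C × D) where
  obj d := (c, d)
  map X Y := (λ_ (X ⟶[V] Y)).inv ≫ eId V c ▷ (X ⟶[V] Y)
  map_id X := by
    rw [prod_eId, leftUnitor_inv_naturality_assoc, whisker_exchange,
      ← MonoidalCategory.tensorHom_def]
  map_comp X Y Z := tensor_insL_aux _ _ _ _ _ (eId_eId_comp c)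

variable (C) in
/-- The `V`-functor `C ⟶ C × D`, `c ↦ (c, d)`. -/
abbrev insR (d : D) : VFun V C (C × D) where
  obj c := (c, d)
  map X Y := (ρ_ (X ⟶[V] Y)).inv ≫ (X ⟶[V] Y) ◁ eId V d
  map_id X := by
    rw [prod_eId, rightUnitor_inv_naturality_assoc, ← whisker_exchange,
      ← MonoidalCategory.tensorHom_def', unitors_inv_equal]
  map_comp X Y Z := tensor_insR_aux _ _ _ _ _ (eId_eId_comp d)

end VFun
end Product

/-! ### Monoidal `V`-categories and their module categories -/

section Modules

variable {V : Type v} [Category.{u} V] [MonoidalCategory V] [SymmetricCategory V]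

variable (V) in
/-- A monoidal structure on the `V`-category `A`: a tensor product `V`-functor, a unit object, an
associator `(a ⊗ b) ⊗ c ≅ a ⊗ (b ⊗ c)` and unitors `1 ⊗ a ≅ a`, `a ⊗ 1 ≅ a`, which are
`V`-natural isomorphisms and satisfy the pentagon and triangle identities. -/
structure MonoidalVCat (A : Type u) [EnrichedCategory V A] where
  /-- The tensor product. -/
  tensor : VFun V (A × A) A
  /-- The unit object. -/
  unit : A
  /-- The associator. -/
  assoc : ((VFun.assocInv V A A A).comp (tensor.prod (VFun.id V A))).comp tensor ≅
    ((VFun.id V A).prod tensor).comp tensor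
  /-- The left unitor. -/
  leftUnitor : (VFun.insL A unit).comp tensor ≅ VFun.id V A
  /-- The right unitor. -/
  rightUnitor : (VFun.insR A unit).comp tensor ≅ VFun.id V A
  pentagon : ∀ a b c d : A,
    tensor.mapHom (pairHom (natApp assoc.hom (a, b, c)) (uId d)) ≫
        natApp assoc.hom (a, tensor.obj (b, c), d) ≫
          tensor.mapHom (pairHom (uId a) (natApp assoc.hom (b, c, d))) =
      natApp assoc.hom (tensor.obj (a, b), c, d) ≫ natApp assoc.hom (a, b, tensor.obj (c, d))
  triangle : ∀ a b : A,
    natApp assoc.hom (a, unit, b) ≫ tensor.mapHom (pairHom (uId a) (natApp leftUnitor.hom b)) =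
      tensor.mapHom (pairHom (natApp rightUnitor.hom a) (uId b))

/-- A right module category over the monoidal `V`-category `A`: an action `V`-functor
`(m, a) ↦ m ◁ a` with `V`-natural isomorphisms `(m ◁ a) ◁ b ≅ m ◁ (a ⊗ b)` and `m ◁ 1 ≅ m`
satisfying the pentagon and triangle identities. -/
structure RightModule {A : Type u} [EnrichedCategory V A] (𝒜 : MonoidalVCat V A)
    (M : Type u) [EnrichedCategory V M] where
  /-- The action. -/
  act : VFun V (M × A) M
  /-- The associativity isomorphism of the action. -/
  assoc : ((VFun.assocInv V M A A).comp (act.prod (VFun.id V A))).comp act ≅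
    ((VFun.id V M).prod 𝒜.tensor).comp act
  /-- The unit isomorphism of the action. -/
  unitor : (VFun.insR M 𝒜.unit).comp act ≅ VFun.id V M
  pentagon : ∀ (m : M) (a b c : A),
    act.mapHom (pairHom (natApp assoc.hom (m, a, b)) (uId c)) ≫
        natApp assoc.hom (m, 𝒜.tensor.obj (a, b), c) ≫
          act.mapHom (pairHom (uId m) (natApp 𝒜.assoc.hom (a, b, c))) =
      natApp assoc.hom (act.obj (m, a), b, c) ≫ natApp assoc.hom (m, a, 𝒜.tensor.obj (b, c))
  triangle : ∀ (m : M) (a : A),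
    natApp assoc.hom (m, 𝒜.unit, a) ≫
        act.mapHom (pairHom (uId m) (natApp 𝒜.leftUnitor.hom a)) =
      act.mapHom (pairHom (natApp unitor.hom m) (uId a))

/-- A left module category over the monoidal `V`-category `A`: an action `V`-functor
`(a, n) ↦ a ▷ n` with `V`-natural isomorphisms `a ▷ (b ▷ n) ≅ (a ⊗ b) ▷ n` and `1 ▷ n ≅ n`
satisfying the pentagon and triangle identities. -/
structure LeftModule {A : Type u} [EnrichedCategory V A] (𝒜 : MonoidalVCat V A)
    (N : Type u) [EnrichedCategory V N] where
  /-- The action. -/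
  act : VFun V (A × N) N
  /-- The associativity isomorphism of the action. -/
  assoc : ((VFun.id V A).prod act).comp act ≅
    ((VFun.assocInv V A A N).comp (𝒜.tensor.prod (VFun.id V N))).comp act
  /-- The unit isomorphism of the action. -/
  unitor : (VFun.insL N 𝒜.unit).comp act ≅ VFun.id V N
  pentagon : ∀ (a b c : A) (n : N),
    natApp assoc.hom (a, b, act.obj (c, n)) ≫ natApp assoc.hom (𝒜.tensor.obj (a, b), c, n) ≫
        act.mapHom (pairHom (natApp 𝒜.assoc.hom (a, b, c)) (uId n)) =
      act.mapHom (pairHom (uId a) (natApp assoc.hom (b, c, n))) ≫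
        natApp assoc.hom (a, 𝒜.tensor.obj (b, c), n)
  triangle : ∀ (a : A) (n : N),
    natApp assoc.hom (a, 𝒜.unit, n) ≫
        act.mapHom (pairHom (natApp 𝒜.rightUnitor.hom a) (uId n)) =
      act.mapHom (pairHom (uId a) (natApp unitor.hom n))

end Modules

/-! ### Diagrams of the shape of the truncated bar construction, cocones and bicolimits -/

section Bicolimits

variable {V : Type v} [Category.{u} V] [MonoidalCategory V]

variable (V) in
/-- A diagram in `V`-Cat consisting of `V`-categories and `V`-functors
`G₀, G₁, G₂ : A ⟶ B` and `F₀, F₁ : B ⟶ C`, and of `V`-natural transformations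
`κ₁ : F₁ ∘ G₀ ⟶ F₀ ∘ G₂`, `κ₂ : F₀ ∘ G₀ ⟶ F₀ ∘ G₁` and `κ₃ : F₁ ∘ G₂ ⟶ F₁ ∘ G₁`.
(This is a strict `2`-functor to `V`-Cat from the `2`-category with three objects that is freely
generated by such `1`- and `2`-morphisms.) -/
structure BarShape (A B C : Type u) [EnrichedCategory V A] [EnrichedCategory V B]
    [EnrichedCategory V C] where
  /-- The first functor `A ⟶ B`. -/
  G₀ : VFun V A B
  /-- The second functor `A ⟶ B`. -/
  G₁ : VFun V A B
  /-- The third functor `A ⟶ B`. -/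
  G₂ : VFun V A B
  /-- The first functor `B ⟶ C`. -/
  F₀ : VFun V B C
  /-- The second functor `B ⟶ C`. -/
  F₁ : VFun V B C
  /-- The first `2`-morphism. -/
  κ₁ : G₀.comp F₁ ⟶ G₂.comp F₀
  /-- The second `2`-morphism. -/
  κ₂ : G₀.comp F₀ ⟶ G₁.comp F₀
  /-- The third `2`-morphism. -/
  κ₃ : G₂.comp F₁ ⟶ G₁.comp F₁

variable {A B C : Type u} [EnrichedCategory V A] [EnrichedCategory V B] [EnrichedCategory V C]

/-- A (pseudo-)cocone with summit `E` over the diagram `X`, i.e. a pseudonatural transformation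
from `X` to the constant diagram at `E`: three `V`-functors `σ_A, σ_B, σ_C` to `E` and `V`-natural
isomorphisms `σ_A ≅ σ_B ∘ G_j`, `σ_B ≅ σ_C ∘ F_i`. For the induced isomorphisms
`Δ_ij = (σ_{F_i} G_j) ∘ σ_{G_j} : σ_A ≅ σ_C ∘ F_i ∘ G_j` one requires
`σ_C κ₁ ∘ Δ₁₀ = Δ₀₂`, `σ_C κ₂ ∘ Δ₀₀ = Δ₀₁` and `σ_C κ₃ ∘ Δ₁₂ = Δ₁₁`. -/
structure BarCocone (X : BarShape V A B C) (E : Type u) [EnrichedCategory V E] where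
  /-- The functor on `A`. -/
  sA : VFun V A E
  /-- The functor on `B`. -/
  sB : VFun V B E
  /-- The functor on `C`. -/
  sC : VFun V C E
  /-- The structure isomorphism for `G₀`. -/
  sG₀ : sA ≅ X.G₀.comp sB
  /-- The structure isomorphism for `G₁`. -/
  sG₁ : sA ≅ X.G₁.comp sB
  /-- The structure isomorphism for `G₂`. -/
  sG₂ : sA ≅ X.G₂.comp sB
  /-- The structure isomorphism for `F₀`. -/
  sF₀ : sB ≅ X.F₀.comp sC
  /-- The structure isomorphism for `F₁`. -/
  sF₁ : sB ≅ X.F₁.comp sC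
  rel₁ : ∀ a : A, (natApp sG₀.hom a ≫ natApp sF₁.hom (X.G₀.obj a)) ≫ sC.mapHom (natApp X.κ₁ a) =
    natApp sG₂.hom a ≫ natApp sF₀.hom (X.G₂.obj a)
  rel₂ : ∀ a : A, (natApp sG₀.hom a ≫ natApp sF₀.hom (X.G₀.obj a)) ≫ sC.mapHom (natApp X.κ₂ a) =
    natApp sG₁.hom a ≫ natApp sF₀.hom (X.G₁.obj a)
  rel₃ : ∀ a : A, (natApp sG₂.hom a ≫ natApp sF₁.hom (X.G₂.obj a)) ≫ sC.mapHom (natApp X.κ₃ a) =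
    natApp sG₁.hom a ≫ natApp sF₁.hom (X.G₁.obj a)

/-- A morphism of cocones with the same summit, i.e. a modification: three `V`-natural
transformations compatible with the structure isomorphisms. -/
@[ext]
structure BarCocone.Hom {X : BarShape V A B C} {E : Type u} [EnrichedCategory V E]
    (σ τ : BarCocone X E) where
  /-- The component at `A`. -/
  hA : σ.sA ⟶ τ.sA
  /-- The component at `B`. -/
  hB : σ.sB ⟶ τ.sB
  /-- The component at `C`. -/
  hC : σ.sC ⟶ τ.sC
  compG₀ : σ.sG₀.hom ≫ VFun.whiskerL X.G₀ hB = hA ≫ τ.sG₀.hom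
  compG₁ : σ.sG₁.hom ≫ VFun.whiskerL X.G₁ hB = hA ≫ τ.sG₁.hom
  compG₂ : σ.sG₂.hom ≫ VFun.whiskerL X.G₂ hB = hA ≫ τ.sG₂.hom
  compF₀ : σ.sF₀.hom ≫ VFun.whiskerL X.F₀ hC = hB ≫ τ.sF₀.hom
  compF₁ : σ.sF₁.hom ≫ VFun.whiskerL X.F₁ hC = hB ≫ τ.sF₁.hom

/-- The category of cocones with summit `E` over the diagram `X`. -/
instance (X : BarShape V A B C) (E : Type u) [EnrichedCategory V E] :
    Category (BarCocone X E) where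
  Hom σ τ := BarCocone.Hom σ τ
  id σ :=
    { hA := 𝟙 _, hB := 𝟙 _, hC := 𝟙 _
      compG₀ := by rw [VFun.whiskerL_id, Category.id_comp, Category.comp_id]
      compG₁ := by rw [VFun.whiskerL_id, Category.id_comp, Category.comp_id]
      compG₂ := by rw [VFun.whiskerL_id, Category.id_comp, Category.comp_id]
      compF₀ := by rw [VFun.whiskerL_id, Category.id_comp, Category.comp_id]
      compF₁ := by rw [VFun.whiskerL_id, Category.id_comp, Category.comp_id] }
  comp f g :=
    { hA := f.hA ≫ g.hA, hB := f.hB ≫ g.hB, hC := f.hC ≫ g.hC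
      compG₀ := by
        rw [VFun.whiskerL_comp, ← Category.assoc, f.compG₀, Category.assoc, g.compG₀,
          Category.assoc]
      compG₁ := by
        rw [VFun.whiskerL_comp, ← Category.assoc, f.compG₁, Category.assoc, g.compG₁,
          Category.assoc]
      compG₂ := by
        rw [VFun.whiskerL_comp, ← Category.assoc, f.compG₂, Category.assoc, g.compG₂,
          Category.assoc]
      compF₀ := by
        rw [VFun.whiskerL_comp, ← Category.assoc, f.compF₀, Category.assoc, g.compF₀,
          Category.assoc]
      compF₁ := by
        rw [VFun.whiskerL_comp, ← Category.assoc, f.compF₁, Category.assoc, g.compF₁,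
          Category.assoc] }
  id_comp f := BarCocone.Hom.ext (Category.id_comp _) (Category.id_comp _) (Category.id_comp _)
  comp_id f := BarCocone.Hom.ext (Category.comp_id _) (Category.comp_id _) (Category.comp_id _)
  assoc f g h := BarCocone.Hom.ext (Category.assoc _ _ _) (Category.assoc _ _ _)
    (Category.assoc _ _ _)

namespace BarCocone

variable {X : BarShape V A B C} {P : Type u} [EnrichedCategory V P]

/-- The cocone obtained from a cocone with summit `P` by composing with a `V`-functor
`H : P ⟶ E`. -/
def push (σ : BarCocone X P) {E : Type u} [EnrichedCategory V E] (H : VFun V P E) :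
    BarCocone X E where
  sA := σ.sA.comp H
  sB := σ.sB.comp H
  sC := σ.sC.comp H
  sG₀ := VFun.postIso σ.sG₀ H
  sG₁ := VFun.postIso σ.sG₁ H
  sG₂ := VFun.postIso σ.sG₂ H
  sF₀ := VFun.postIso σ.sF₀ H
  sF₁ := VFun.postIso σ.sF₁ H
  rel₁ a := by
    have h := congrArg H.mapHom (σ.rel₁ a)
    have e := VFun.comp_mapHom σ.sC H (natApp X.κ₁ a)
    exact (congrArg (_ ≫ ·) e).trans ((congrArg (· ≫ _) (H.mapHom_comp _ _).symm).trans
      ((H.mapHom_comp _ _).symm.trans (h.trans (H.mapHom_comp _ _))))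
  rel₂ a := by
    have h := congrArg H.mapHom (σ.rel₂ a)
    have e := VFun.comp_mapHom σ.sC H (natApp X.κ₂ a)
    exact (congrArg (_ ≫ ·) e).trans ((congrArg (· ≫ _) (H.mapHom_comp _ _).symm).trans
      ((H.mapHom_comp _ _).symm.trans (h.trans (H.mapHom_comp _ _))))
  rel₃ a := by
    have h := congrArg H.mapHom (σ.rel₃ a)
    have e := VFun.comp_mapHom σ.sC H (natApp X.κ₃ a)
    exact (congrArg (_ ≫ ·) e).trans ((congrArg (· ≫ _) (H.mapHom_comp _ _).symm).trans
      ((H.mapHom_comp _ _).symm.trans (h.trans (H.mapHom_comp _ _))))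

/-- The functor from `V`-functors `P ⟶ E` to cocones with summit `E` given by composition with a
cocone with summit `P`. -/
def pushFunctor (σ : BarCocone X P) (E : Type u) [EnrichedCategory V E] :
    VFun V P E ⥤ BarCocone X E where
  obj H := σ.push H
  map {H K} α :=
    { hA := VFun.whiskerL σ.sA α
      hB := VFun.whiskerL σ.sB α
      hC := VFun.whiskerL σ.sC α
      compG₀ := nat_ext fun x => α.naturality_hom (natApp σ.sG₀.hom x)
      compG₁ := nat_ext fun x => α.naturality_hom (natApp σ.sG₁.hom x)
      compG₂ := nat_ext fun x => α.naturality_hom (natApp σ.sG₂.hom x)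
      compF₀ := nat_ext fun x => α.naturality_hom (natApp σ.sF₀.hom x)
      compF₁ := nat_ext fun x => α.naturality_hom (natApp σ.sF₁.hom x) }

/-- A cocone with summit `P` exhibits `P` as the bicolimit of the diagram `X` if, for every
`V`-category `E`, composition with it is an equivalence from the category of `V`-functors
`P ⟶ E` and `V`-natural transformations to the category of cocones with summit `E`. -/
def IsBicolimit (σ : BarCocone X P) : Prop :=
  ∀ (E : Type u) [EnrichedCategory V E], (σ.pushFunctor E).IsEquivalence

end BarCocone

end Bicolimits

/-! ### The truncated bar construction -/

section Bar

variable {V : Type v} [Category.{u} V] [MonoidalCategory V]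

lemma bar_aux₁ {P Q R S T W : V} (f : P ⊗ Q ⟶ S) (g : R ⊗ W ⟶ T) :
    ((α_ P Q (R ⊗ W)).inv ≫ (f ⊗ₘ 𝟙 (R ⊗ W))) ≫ (𝟙 S ⊗ₘ g) =
      (𝟙 P ⊗ₘ (𝟙 Q ⊗ₘ g)) ≫ (α_ P Q T).inv ≫ (f ⊗ₘ 𝟙 T) := by
  rw [Category.assoc, MonoidalCategory.tensorHom_comp_tensorHom, associator_inv_naturality_assoc,
    MonoidalCategory.tensorHom_comp_tensorHom]
  simp

lemma bar_aux₂ {P Q R S T W : V} (f : P ⊗ Q ⟶ S) (g : S ⊗ R ⟶ T) :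
    ((α_ P Q (R ⊗ W)).inv ≫ (f ⊗ₘ 𝟙 (R ⊗ W))) ≫ (α_ S R W).inv ≫ (g ⊗ₘ 𝟙 W) =
      (P ◁ (α_ Q R W).inv ≫ (α_ P (Q ⊗ R) W).inv) ≫
        ((((α_ P Q R).inv ≫ (f ⊗ₘ 𝟙 R)) ≫ g) ⊗ₘ 𝟙 W) := by
  simp only [MonoidalCategory.tensorHom_id, comp_whiskerRight]
  monoidal

lemma bar_aux₃ {P Q R S T W : V} (t : Q ⊗ R ⟶ S) (g : P ⊗ S ⟶ T) :
    (𝟙 P ⊗ₘ ((α_ Q R W).inv ≫ (t ⊗ₘ 𝟙 W))) ≫ (α_ P S W).inv ≫ (g ⊗ₘ 𝟙 W) =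
      (P ◁ (α_ Q R W).inv ≫ (α_ P (Q ⊗ R) W).inv) ≫ (((𝟙 P ⊗ₘ t) ≫ g) ⊗ₘ 𝟙 W) := by
  simp only [MonoidalCategory.tensorHom_id, MonoidalCategory.id_tensorHom, comp_whiskerRight]
  monoidal

lemma bar_aux₄ {P R S S' T W : V} (k : P ⟶ R ⊗ W) {f : R ⟶ S} {f' : R ⟶ S'} {g : S ⟶ T}
    {g' : S' ⟶ T} (h : f ≫ g = f' ≫ g') :
    (k ≫ (f ⊗ₘ 𝟙 W)) ≫ (g ⊗ₘ 𝟙 W) = (k ≫ (f' ⊗ₘ 𝟙 W)) ≫ (g' ⊗ₘ 𝟙 W) := by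
  rw [Category.assoc, Category.assoc, MonoidalCategory.tensorHom_comp_tensorHom,
    MonoidalCategory.tensorHom_comp_tensorHom, h]

variable [SymmetricCategory V] {A M N : Type u} [EnrichedCategory V A] [EnrichedCategory V M]
  [EnrichedCategory V N] {𝒜 : MonoidalVCat V A}

/-- The action on the left factor, `(m, a, n) ↦ (m ◁ a, n)`. -/
abbrev actRight (R : RightModule 𝒜 M) (N : Type u) [EnrichedCategory V N] :
    VFun V (M × A × N) (M × N) :=
  (VFun.assocInv V M A N).comp (R.act.prod (VFun.id V N))

/-- The action on the right factor, `(m, a, n) ↦ (m, a ▷ n)`. -/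
abbrev actLeft (L : LeftModule 𝒜 N) (M : Type u) [EnrichedCategory V M] :
    VFun V (M × A × N) (M × N) :=
  (VFun.id V M).prod L.act

/-- The truncated bar construction: the diagram
`M × A × A × N ⇶ M × A × N ⇉ M × N` whose functors are `(m, a, b, n) ↦ (m ◁ a, b, n)`,
`(m, a ⊗ b, n)`, `(m, a, b ▷ n)` and `(m, a, n) ↦ (m ◁ a, n)`, `(m, a ▷ n)`; its `2`-morphisms are
the identity of `(m ◁ a, b ▷ n)` and the associativity isomorphisms of the two actions. -/
def barDiagram (R : RightModule 𝒜 M) (L : LeftModule 𝒜 N) :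
    BarShape V (M × A × A × N) (M × A × N) (M × N) where
  G₀ := actRight R (A × N)
  G₁ := (VFun.id V M).prod
    ((VFun.assocInv V A A N).comp (𝒜.tensor.prod (VFun.id V N)))
  G₂ := (VFun.id V M).prod ((VFun.id V A).prod L.act)
  F₀ := actRight R N
  F₁ := actLeft L M
  κ₁ := VNatTrans.mk (fun x => uId (R.act.obj (x.1, x.2.1), L.act.obj (x.2.2.1, x.2.2.2)))
    (fun x y => by
      rw [postcomp_id, precomp_id, Category.comp_id, Category.comp_id]
      exact bar_aux₁ _ _)
  κ₂ := VNatTrans.mk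
    (fun x => pairHom (natApp R.assoc.hom (x.1, x.2.1, x.2.2.1)) (uId x.2.2.2))
    (fun x y => by
      have h := R.assoc.hom.naturality (x.1, x.2.1, x.2.2.1) (y.1, y.2.1, y.2.2.1)
      rw [postcomp_pairHom, precomp_pairHom, postcomp_id, precomp_id]
      dsimp only at h ⊢
      exact (congrArg (· ≫ _) (bar_aux₂ _ _)).trans ((bar_aux₄ _ h).trans
        (congrArg (· ≫ _) (bar_aux₃ _ _)).symm))
  κ₃ := VNatTrans.mk
    (fun x => pairHom (uId x.1) (natApp L.assoc.hom (x.2.1, x.2.2.1, x.2.2.2)))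
    (fun x y => by
      have h := L.assoc.hom.naturality x.2 y.2
      rw [postcomp_pairHom, precomp_pairHom, postcomp_id, precomp_id]
      dsimp only at h ⊢
      simp only [MonoidalCategory.tensorHom_comp_tensorHom, Category.comp_id]
      exact congrArg (fun k => 𝟙 (x.1 ⟶[V] y.1) ⊗ₘ k) h)

end Bar

/-! ### Free `V`-categories and quotients of `V`-categories -/

section Presentations

variable {V : Type v} [Category.{u} V] [MonoidalCategory V]

section Free

variable {S : Type u}

/-- Finite sequences `(A, X₁, …, Xₙ, B)` of elements of `S` starting at `A` and ending at `B`,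
recorded as sequences of steps; `nil A` is the empty sequence of steps from `A` to `A`. -/
inductive Word : S → S → Type u
  | nil (A : S) : Word A A
  | cons (A : S) {X B : S} (w : Word X B) : Word A B

namespace Word

/-- Concatenation. -/
def append : ∀ {A B C : S}, Word A B → Word B C → Word A C
  | _, _, _, nil _, w' => w'
  | _, _, _, cons A w, w' => cons A (append w w')

lemma append_nil : ∀ {A B : S} (w : Word A B), w.append (nil B) = w
  | _, _, nil _ => rfl
  | _, _, cons A w => congrArg (cons A) (append_nil w)

lemma append_assoc : ∀ {A B C D : S} (w : Word A B) (w' : Word B C) (w'' : Word C D),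
    (w.append w').append w'' = w.append (w'.append w'')
  | _, _, _, _, nil _, _, _ => rfl
  | _, _, _, _, cons A w, w', w'' => congrArg (cons A) (append_assoc w w' w'')

/-- The object `Ω(A, X₁) ⊗ (Ω(X₁, X₂) ⊗ ( … ))` of paths along a given sequence; it is the unit of
`V` for the empty sequence. -/
def obj (Ω : S → S → V) : ∀ {A B : S}, Word A B → V
  | _, _, nil _ => 𝟙_ V
  | _, _, @cons _ A X _ w => Ω A X ⊗ obj Ω w

/-- The canonical morphism (in fact, isomorphism) given by reassociation and the unitors. -/
def mul (Ω : S → S → V) : ∀ {A B C : S} (w : Word A B) (w' : Word B C),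
    w.obj Ω ⊗ w'.obj Ω ⟶ (w.append w').obj Ω
  | _, _, _, nil _, w' => (λ_ (w'.obj Ω)).hom
  | _, _, _, @cons _ A X _ w, w' =>
    (α_ (Ω A X) (w.obj Ω) (w'.obj Ω)).hom ≫ Ω A X ◁ mul Ω w w'

end Word

lemma word_mul_nil_aux {P W W' : V} (m : W ⊗ 𝟙_ V ⟶ W') (h : W' = W)
    (ih : m ≫ eqToHom h = (ρ_ W).hom) :
    ((α_ P W (𝟙_ V)).hom ≫ P ◁ m) ≫ eqToHom (congrArg (P ⊗ ·) h) = (ρ_ (P ⊗ W)).hom := by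
  subst h
  simp only [eqToHom_refl, Category.comp_id] at ih ⊢
  rw [ih]; simp

lemma word_mul_nil (Ω : S → S → V) : ∀ {A B : S} (w : Word A B),
    Word.mul Ω w (Word.nil B) ≫ eqToHom (congrArg (Word.obj Ω) w.append_nil) =
      (ρ_ (w.obj Ω)).hom
  | _, _, Word.nil A => (Category.comp_id (λ_ (𝟙_ V)).hom).trans unitors_equal
  | _, _, Word.cons A w => word_mul_nil_aux _ (congrArg (Word.obj Ω) w.append_nil) (word_mul_nil Ω w)

lemma word_mul_assoc_aux {P W W' W'' X Y Z Z' : V} (m : W ⊗ W' ⟶ X) (n : X ⊗ W'' ⟶ Z)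
    (m' : W' ⊗ W'' ⟶ Y) (n' : W ⊗ Y ⟶ Z') (h : Z = Z')
    (ih : (m ▷ W'' ≫ n) ≫ eqToHom h = (α_ W W' W'').hom ≫ W ◁ m' ≫ n') :
    ((((α_ P W W').hom ≫ P ◁ m) ▷ W'') ≫ ((α_ P X W'').hom ≫ P ◁ n)) ≫
        eqToHom (congrArg (P ⊗ ·) h) =
      (α_ (P ⊗ W) W' W'').hom ≫ (P ⊗ W) ◁ m' ≫ ((α_ P W Y).hom ≫ P ◁ n') := by
  subst h
  simp only [eqToHom_refl, Category.comp_id] at ih ⊢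
  rw [associator_naturality_right_assoc, ← MonoidalCategory.whiskerLeft_comp,
    comp_whiskerRight, Category.assoc, associator_naturality_middle_assoc,
    ← MonoidalCategory.whiskerLeft_comp, ih, MonoidalCategory.whiskerLeft_comp, pentagon_assoc]

lemma word_mul_assoc (Ω : S → S → V) : ∀ {A B C D : S} (w : Word A B) (w' : Word B C)
    (w'' : Word C D),
    (Word.mul Ω w w' ▷ w''.obj Ω ≫ Word.mul Ω (w.append w') w'') ≫
        eqToHom (congrArg (Word.obj Ω) (w.append_assoc w' w'')) =
      (α_ (w.obj Ω) (w'.obj Ω) (w''.obj Ω)).hom ≫ w.obj Ω ◁ Word.mul Ω w' w'' ≫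
        Word.mul Ω w (w'.append w'')
  | _, _, _, _, Word.nil A, w', w'' => by
    refine (Category.comp_id _).trans ?_
    show (λ_ (w'.obj Ω)).hom ▷ w''.obj Ω ≫ Word.mul Ω w' w'' =
      (α_ (𝟙_ V) (w'.obj Ω) (w''.obj Ω)).hom ≫ 𝟙_ V ◁ Word.mul Ω w' w'' ≫ (λ_ _).hom
    simp
  | _, _, _, _, Word.cons A w, w', w'' => word_mul_assoc_aux _ _ _ _
      (congrArg (Word.obj Ω) (w.append_assoc w' w'')) (word_mul_assoc Ω w w' w'')

end Free

section Closed

variable [SymmetricCategory V] [MonoidalClosed V] [HasColimits V] {ι κ : Type u}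

/-- A morphism out of `X ⊗ ∐ g` given on the summands. -/
noncomputable def sigmaDescR (X : V) {g : κ → V} {Z : V} (h : ∀ j, X ⊗ g j ⟶ Z) :
    X ⊗ ∐ g ⟶ Z :=
  MonoidalClosed.uncurry (Sigma.desc fun j => MonoidalClosed.curry (h j))

lemma whiskerLeft_ι_sigmaDescR (X : V) {g : κ → V} {Z : V} (h : ∀ j, X ⊗ g j ⟶ Z) (j : κ) :
    X ◁ Sigma.ι g j ≫ sigmaDescR X h = h j := by
  unfold sigmaDescR
  rw [← MonoidalClosed.uncurry_natural_left, Sigma.ι_desc, MonoidalClosed.uncurry_curry]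

lemma sigma_ext_right (X : V) {g : κ → V} {Z : V} {p q : X ⊗ ∐ g ⟶ Z}
    (h : ∀ j, X ◁ Sigma.ι g j ≫ p = X ◁ Sigma.ι g j ≫ q) : p = q := by
  apply MonoidalClosed.curry_injective
  refine Sigma.hom_ext _ _ fun j => ?_
  rw [← MonoidalClosed.curry_natural_left, ← MonoidalClosed.curry_natural_left, h]

/-- A morphism out of `∐ f ⊗ Y` given on the summands. -/
noncomputable def sigmaDescL {f : ι → V} (Y : V) {Z : V} (h : ∀ i, f i ⊗ Y ⟶ Z) :
    (∐ f) ⊗ Y ⟶ Z :=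
  (β_ (∐ f) Y).hom ≫ sigmaDescR Y fun i => (β_ Y (f i)).hom ≫ h i

lemma ι_whiskerRight_sigmaDescL {f : ι → V} (Y : V) {Z : V} (h : ∀ i, f i ⊗ Y ⟶ Z) (i : ι) :
    Sigma.ι f i ▷ Y ≫ sigmaDescL Y h = h i := by
  unfold sigmaDescL
  rw [BraidedCategory.braiding_naturality_left_assoc, whiskerLeft_ι_sigmaDescR,
    SymmetricCategory.symmetry_assoc]

lemma sigma_ext_left {f : ι → V} (Y : V) {Z : V} {p q : (∐ f) ⊗ Y ⟶ Z}
    (h : ∀ i, Sigma.ι f i ▷ Y ≫ p = Sigma.ι f i ▷ Y ≫ q) : p = q := by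
  rw [← cancel_epi (β_ Y (∐ f)).hom]
  refine sigma_ext_right _ fun j => ?_
  rw [BraidedCategory.braiding_naturality_right_assoc,
    BraidedCategory.braiding_naturality_right_assoc, h]

lemma sigma_ext_tensor {f : ι → V} {g : κ → V} {Z : V} {p q : (∐ f) ⊗ (∐ g) ⟶ Z}
    (h : ∀ i j, (Sigma.ι f i ⊗ₘ Sigma.ι g j) ≫ p = (Sigma.ι f i ⊗ₘ Sigma.ι g j) ≫ q) : p = q := by
  refine sigma_ext_left _ fun i => sigma_ext_right _ fun j => ?_
  have := h i j
  rw [MonoidalCategory.tensorHom_def', Category.assoc, Category.assoc] at this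
  exact this

lemma tensor_curry_ext {P W Z : V} {p q : P ⊗ W ⟶ Z}
    (h : MonoidalClosed.curry ((β_ W P).hom ≫ p) = MonoidalClosed.curry ((β_ W P).hom ≫ q)) :
    p = q := by
  have := MonoidalClosed.curry_injective h
  rwa [cancel_epi] at this

lemma sigma_ext_triple {μ : Type u} {f : ι → V} {g : κ → V} {k : μ → V} {Z : V}
    {p q : ((∐ f) ⊗ (∐ g)) ⊗ (∐ k) ⟶ Z}
    (h : ∀ i j l, ((Sigma.ι f i ⊗ₘ Sigma.ι g j) ⊗ₘ Sigma.ι k l) ≫ p =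
      ((Sigma.ι f i ⊗ₘ Sigma.ι g j) ⊗ₘ Sigma.ι k l) ≫ q) : p = q := by
  refine sigma_ext_right _ fun l => tensor_curry_ext (sigma_ext_tensor fun i j => ?_)
  rw [← MonoidalClosed.curry_natural_left, ← MonoidalClosed.curry_natural_left,
    BraidedCategory.braiding_naturality_right_assoc,
    BraidedCategory.braiding_naturality_right_assoc]
  have := h i j l
  rw [MonoidalCategory.tensorHom_def, Category.assoc, Category.assoc] at this
  rw [this]

end Closed

section Free

variable [SymmetricCategory V] [MonoidalClosed V] [HasColimits V] {S : Type u}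

/-- The hom-object from `A` to `B` of the free `V`-category on `Ω`. -/
noncomputable abbrev freeHom (Ω : S → S → V) (A B : S) : V := ∐ fun w : Word A B => w.obj Ω

/-- The inclusion of the summand of a given word. -/
noncomputable def freeι (Ω : S → S → V) {A B : S} (w : Word A B) : w.obj Ω ⟶ freeHom Ω A B :=
  Sigma.ι (fun w : Word A B => w.obj Ω) w

lemma freeι_congr (Ω : S → S → V) {A B : S} {w w' : Word A B} (h : w = w') :
    eqToHom (by rw [h]) ≫ freeι Ω w' = freeι Ω w := by
  subst h; simp

/-- Composition in the free `V`-category, given by concatenation of words. -/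
noncomputable def freeComp (Ω : S → S → V) (A B C : S) :
    freeHom Ω A B ⊗ freeHom Ω B C ⟶ freeHom Ω A C :=
  sigmaDescL _ fun w => sigmaDescR _ fun w' => Word.mul Ω w w' ≫ freeι Ω (w.append w')

lemma ι_freeComp (Ω : S → S → V) {A B C : S} (w : Word A B) (w' : Word B C) :
    (freeι Ω w ⊗ₘ freeι Ω w') ≫ freeComp Ω A B C = Word.mul Ω w w' ≫ freeι Ω (w.append w') := by
  unfold freeComp
  rw [MonoidalCategory.tensorHom_def', Category.assoc]
  refine (congrArg (_ ≫ ·) (ι_whiskerRight_sigmaDescL _ _ w)).trans ?_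
  exact whiskerLeft_ι_sigmaDescR _ _ w'

lemma ι_whiskerRight_freeComp (Ω : S → S → V) {A B C : S} (w : Word A B) (w' : Word B C) :
    w.obj Ω ◁ freeι Ω w' ≫ freeι Ω w ▷ _ ≫ freeComp Ω A B C =
      Word.mul Ω w w' ≫ freeι Ω (w.append w') := by
  rw [← ι_freeComp, MonoidalCategory.tensorHom_def', Category.assoc]

lemma free_id_comp (Ω : S → S → V) (A B : S) :
    (λ_ (freeHom Ω A B)).inv ≫ freeι Ω (Word.nil A) ▷ freeHom Ω A B ≫ freeComp Ω A A B =
      𝟙 _ := by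
  rw [Iso.inv_comp_eq, Category.comp_id]
  refine sigma_ext_right _ fun w => ?_
  refine (ι_whiskerRight_freeComp Ω (Word.nil A) w).trans ?_
  exact (leftUnitor_naturality (freeι Ω w)).symm

lemma free_comp_id (Ω : S → S → V) (A B : S) :
    (ρ_ (freeHom Ω A B)).inv ≫ freeHom Ω A B ◁ freeι Ω (Word.nil B) ≫ freeComp Ω A B B =
      𝟙 _ := by
  rw [Iso.inv_comp_eq, Category.comp_id]
  refine sigma_ext_left _ fun w => ?_
  have h := ι_freeComp Ω w (Word.nil B)
  rw [MonoidalCategory.tensorHom_def, Category.assoc, ← freeι_congr Ω w.append_nil,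
    ← Category.assoc (Word.mul Ω w (Word.nil B)), word_mul_nil] at h
  exact h.trans (rightUnitor_naturality (freeι Ω w)).symm

lemma free_assoc (Ω : S → S → V) (A B C D : S) :
    (α_ (freeHom Ω A B) (freeHom Ω B C) (freeHom Ω C D)).inv ≫
        freeComp Ω A B C ▷ freeHom Ω C D ≫ freeComp Ω A C D =
      freeHom Ω A B ◁ freeComp Ω B C D ≫ freeComp Ω A B D := by
  rw [Iso.inv_comp_eq]
  have key : ∀ (w : Word A B) (w' : Word B C) (w'' : Word C D),
      ((freeι Ω w ⊗ₘ freeι Ω w') ⊗ₘ freeι Ω w'') ≫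
        freeComp Ω A B C ▷ freeHom Ω C D ≫ freeComp Ω A C D =
      ((freeι Ω w ⊗ₘ freeι Ω w') ⊗ₘ freeι Ω w'') ≫ (α_ _ _ _).hom ≫
        freeHom Ω A B ◁ freeComp Ω B C D ≫ freeComp Ω A B D := fun w w' w'' => by
    have h := word_mul_assoc Ω w w' w''
    rw [associator_naturality_assoc, ← tensorHom_id, ← id_tensorHom,
      MonoidalCategory.tensorHom_comp_tensorHom_assoc,
      MonoidalCategory.tensorHom_comp_tensorHom_assoc, Category.comp_id, Category.comp_id,
      ι_freeComp, ι_freeComp, ← whiskerRight_comp_tensorHom, ← whiskerLeft_comp_tensorHom,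
      Category.assoc, Category.assoc, ι_freeComp, ι_freeComp,
      ← freeι_congr Ω (w.append_assoc w' w''), ← Category.assoc, ← Category.assoc,
      ← Category.assoc, ← Category.assoc]
    rw [h]
    simp only [Category.assoc]
  exact sigma_ext_triple key

/-- The free `V`-category on the `V`-graph `Ω` with set of vertices `S`. Its objects are the
elements of `S`, the hom-object from `A` to `B` is the coproduct, over all finite sequences
`(A, X₁, …, Xₙ, B)`, of the objects `Ω(A, X₁) ⊗ … ⊗ Ω(Xₙ, B)` and, if `A = B`, of one further
summand `𝟙_ V`, and the composition is concatenation. -/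
def FreeVCat (_Ω : S → S → V) : Type u := S

noncomputable instance freeEnriched (Ω : S → S → V) : EnrichedCategory V (FreeVCat Ω) where
  Hom A B := freeHom (S := S) Ω A B
  id A := freeι (S := S) Ω (Word.nil A)
  comp A B C := freeComp (S := S) Ω A B C
  id_comp A B := free_id_comp (S := S) Ω A B
  comp_id A B := free_comp_id (S := S) Ω A B
  assoc A B C D := free_assoc (S := S) Ω A B C D

/-- An element of `S` as an object of the free `V`-category. -/
abbrev FreeVCat.of (Ω : S → S → V) (A : S) : FreeVCat Ω := A

/-- The canonical morphism from `Ω(A, B)` to the hom-object of the free `V`-category. -/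
noncomputable def FreeVCat.gen (Ω : S → S → V) (A B : S) :
    Ω A B ⟶ (FreeVCat.of Ω A ⟶[V] FreeVCat.of Ω B) :=
  (ρ_ (Ω A B)).inv ≫ freeι Ω (Word.cons A (Word.nil B))

end Free

section Quotient

variable (V) in
/-- A pair of morphisms `lhs, rhs : obj ⟶ C(src, tgt)` in `V` that are to be identified. -/
structure VRel (C : Type u) [EnrichedCategory V C] where
  /-- The source. -/
  src : C
  /-- The target. -/
  tgt : C
  /-- The parametrizing object of `V`. -/
  obj : V
  /-- The left hand side. -/
  lhs : obj ⟶ (src ⟶[V] tgt)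
  /-- The right hand side. -/
  rhs : obj ⟶ (src ⟶[V] tgt)

variable {C : Type u} [EnrichedCategory V C]

/-- The morphism `C(a, x) ⊗ (P ⊗ C(y, b)) ⟶ C(a, b)` given by inserting `f : P ⟶ C(x, y)` and
composing. -/
def sandwich {x y : C} {P : V} (f : P ⟶ (x ⟶[V] y)) (a b : C) :
    (a ⟶[V] x) ⊗ (P ⊗ (y ⟶[V] b)) ⟶ (a ⟶[V] b) :=
  (a ⟶[V] x) ◁ (f ▷ (y ⟶[V] b) ≫ eComp V x y b) ≫ eComp V a x b

lemma sandwich_comp {x y : C} {P : V} (f : P ⟶ (x ⟶[V] y)) (a b c : C) :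
    sandwich f a b ▷ (b ⟶[V] c) ≫ eComp V a b c =
      ((α_ (a ⟶[V] x) (P ⊗ (y ⟶[V] b)) (b ⟶[V] c)).hom ≫ (a ⟶[V] x) ◁ ((α_ P _ _).hom ≫
        P ◁ eComp V y b c)) ≫ sandwich f a c := by
  unfold sandwich
  simp only [comp_whiskerRight, MonoidalCategory.whiskerLeft_comp, Category.assoc]
  have h : (f ▷ (y ⟶[V] b)) ▷ (b ⟶[V] c) ≫ eComp V x y b ▷ (b ⟶[V] c) ≫ eComp V x b c =
      (α_ P (y ⟶[V] b) (b ⟶[V] c)).hom ≫ P ◁ eComp V y b c ≫ f ▷ (y ⟶[V] c) ≫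
        eComp V x y c := by
    rw [← e_assoc' V x y b c, associator_naturality_left_assoc, ← whisker_exchange_assoc]
  rw [← e_assoc' V a x b c, associator_naturality_middle_assoc,
    associator_naturality_middle_assoc]
  simp only [← MonoidalCategory.whiskerLeft_comp, ← Category.assoc] at h ⊢
  simp only [Category.assoc] at h ⊢
  rw [h]

lemma comp_sandwich {x y : C} {P : V} (f : P ⟶ (x ⟶[V] y)) (a b c : C) :
    (c ⟶[V] a) ◁ sandwich f a b ≫ eComp V c a b =
      ((α_ (c ⟶[V] a) (a ⟶[V] x) (P ⊗ (y ⟶[V] b))).inv ≫ eComp V c a x ▷ _) ≫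
        sandwich f c b := by
  unfold sandwich
  simp only [MonoidalCategory.whiskerLeft_comp, Category.assoc]
  rw [← e_assoc V c a x b, associator_inv_naturality_right_assoc,
    associator_inv_naturality_right_assoc, whisker_exchange_assoc, whisker_exchange_assoc]

variable [HasColimits V] {I : Type u} (r : I → VRel V C)

/-- The first morphism of the coequalizer diagram for the hom-object of the quotient. -/
noncomputable def relL (a b : C) :
    (∐ fun i => (a ⟶[V] (r i).src) ⊗ ((r i).obj ⊗ ((r i).tgt ⟶[V] b))) ⟶ (a ⟶[V] b) :=
  Sigma.desc fun i => sandwich (r i).lhs a b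

/-- The second morphism of the coequalizer diagram for the hom-object of the quotient. -/
noncomputable def relR (a b : C) :
    (∐ fun i => (a ⟶[V] (r i).src) ⊗ ((r i).obj ⊗ ((r i).tgt ⟶[V] b))) ⟶ (a ⟶[V] b) :=
  Sigma.desc fun i => sandwich (r i).rhs a b

/-- The hom-objects of the quotient. -/
noncomputable abbrev quotHom (a b : C) : V := coequalizer (relL r a b) (relR r a b)

/-- The projection to the hom-objects of the quotient. -/
noncomputable abbrev quotπ (a b : C) : (a ⟶[V] b) ⟶ quotHom r a b :=
  coequalizer.π (relL r a b) (relR r a b)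

lemma sandwich_quotπ (i : I) (a b : C) :
    sandwich (r i).lhs a b ≫ quotπ r a b = sandwich (r i).rhs a b ≫ quotπ r a b := by
  have h := congrArg (Sigma.ι (fun i => (a ⟶[V] (r i).src) ⊗ ((r i).obj ⊗ ((r i).tgt ⟶[V] b))) i
    ≫ ·) (coequalizer.condition (relL r a b) (relR r a b))
  rw [← Category.assoc, ← Category.assoc] at h
  have e₁ := Sigma.ι_desc (fun i => sandwich (r i).lhs a b) i
  have e₂ := Sigma.ι_desc (fun i => sandwich (r i).rhs a b) i
  exact (congrArg (· ≫ _) e₁).symm.trans (h.trans (congrArg (· ≫ _) e₂))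

variable [SymmetricCategory V] [MonoidalClosed V]

/-- Composition of a morphism with a morphism of the quotient. -/
noncomputable def quotCompR (a b c : C) : (a ⟶[V] b) ⊗ quotHom r b c ⟶ quotHom r a c :=
  MonoidalClosed.uncurry (coequalizer.desc
    (MonoidalClosed.curry (eComp V a b c ≫ quotπ r a c)) (by
      refine Sigma.hom_ext _ _ fun i => ?_
      simp only [relL, relR, Sigma.ι_desc_assoc]
      rw [← MonoidalClosed.curry_natural_left, ← MonoidalClosed.curry_natural_left,
        ← Category.assoc, ← Category.assoc, comp_sandwich, comp_sandwich, Category.assoc,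
        Category.assoc _ (sandwich (r i).rhs _ _), sandwich_quotπ]))

lemma quotπ_quotCompR (a b c : C) :
    (a ⟶[V] b) ◁ quotπ r b c ≫ quotCompR r a b c = eComp V a b c ≫ quotπ r a c := by
  unfold quotCompR
  rw [← MonoidalClosed.uncurry_natural_left, coequalizer.π_desc, MonoidalClosed.uncurry_curry]

lemma epi_whiskerLeft {P Q : V} (f : P ⟶ Q) [Epi f] (X : V) : Epi (X ◁ f) :=
  inferInstanceAs (Epi ((tensorLeft X).map f))

lemma epi_whiskerRight {P Q : V} (f : P ⟶ Q) [Epi f] (X : V) : Epi (f ▷ X) :=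
  inferInstanceAs (Epi ((tensorRight X).map f))

lemma relL_quotCompR (i : I) (a b c : C) :
    sandwich (r i).lhs a b ▷ quotHom r b c ≫ quotCompR r a b c =
      sandwich (r i).rhs a b ▷ quotHom r b c ≫ quotCompR r a b c := by
  have := epi_whiskerLeft (quotπ r b c) ((a ⟶[V] (r i).src) ⊗ ((r i).obj ⊗ ((r i).tgt ⟶[V] b)))
  rw [← cancel_epi (((a ⟶[V] (r i).src) ⊗ ((r i).obj ⊗ ((r i).tgt ⟶[V] b))) ◁ quotπ r b c),
    whisker_exchange_assoc, whisker_exchange_assoc, quotπ_quotCompR, ← Category.assoc,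
    ← Category.assoc, sandwich_comp, sandwich_comp, Category.assoc,
    Category.assoc _ (sandwich (r i).rhs _ _), sandwich_quotπ]

/-- Composition in the quotient. -/
noncomputable def quotComp (a b c : C) : quotHom r a b ⊗ quotHom r b c ⟶ quotHom r a c :=
  (β_ _ _).hom ≫ MonoidalClosed.uncurry (coequalizer.desc
    (MonoidalClosed.curry ((β_ _ _).hom ≫ quotCompR r a b c)) (by
      refine Sigma.hom_ext _ _ fun i => ?_
      simp only [relL, relR, Sigma.ι_desc_assoc]
      rw [← MonoidalClosed.curry_natural_left, ← MonoidalClosed.curry_natural_left,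
        BraidedCategory.braiding_naturality_right_assoc,
        BraidedCategory.braiding_naturality_right_assoc, relL_quotCompR]))

lemma quotπ_quotComp (a b c : C) :
    (quotπ r a b ⊗ₘ quotπ r b c) ≫ quotComp r a b c = eComp V a b c ≫ quotπ r a c := by
  rw [MonoidalCategory.tensorHom_def', Category.assoc]
  unfold quotComp
  rw [BraidedCategory.braiding_naturality_left_assoc, ← MonoidalClosed.uncurry_natural_left,
    coequalizer.π_desc, MonoidalClosed.uncurry_curry, SymmetricCategory.symmetry_assoc,
    quotπ_quotCompR]

lemma quot_id_comp (a b : C) :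
    (λ_ (quotHom r a b)).inv ≫ (eId V a ≫ quotπ r a a) ▷ quotHom r a b ≫ quotComp r a a b =
      𝟙 _ := by
  have h := quotπ_quotComp r a a b
  rw [MonoidalCategory.tensorHom_def, Category.assoc] at h
  rw [← cancel_epi (quotπ r a b), leftUnitor_inv_naturality_assoc, whisker_exchange_assoc,
    comp_whiskerRight, Category.assoc, h, e_id_comp_assoc, Category.comp_id]

lemma quot_comp_id (a b : C) :
    (ρ_ (quotHom r a b)).inv ≫ quotHom r a b ◁ (eId V b ≫ quotπ r b b) ≫ quotComp r a b b =
      𝟙 _ := by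
  have h := quotπ_quotComp r a b b
  rw [MonoidalCategory.tensorHom_def', Category.assoc] at h
  rw [← cancel_epi (quotπ r a b), rightUnitor_inv_naturality_assoc, ← whisker_exchange_assoc,
    MonoidalCategory.whiskerLeft_comp, Category.assoc, h, e_comp_id_assoc, Category.comp_id]

lemma quot_assoc (a b c d : C) :
    (α_ (quotHom r a b) (quotHom r b c) (quotHom r c d)).inv ≫
        quotComp r a b c ▷ quotHom r c d ≫ quotComp r a c d =
      quotHom r a b ◁ quotComp r b c d ≫ quotComp r a b d := by
  have key : (quotπ r a b ⊗ₘ (quotπ r b c ⊗ₘ quotπ r c d)) ≫ (α_ _ _ _).inv ≫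
        quotComp r a b c ▷ quotHom r c d ≫ quotComp r a c d =
      (quotπ r a b ⊗ₘ (quotπ r b c ⊗ₘ quotπ r c d)) ≫
        quotHom r a b ◁ quotComp r b c d ≫ quotComp r a b d := by
    rw [associator_inv_naturality_assoc, ← tensorHom_id, ← id_tensorHom,
      MonoidalCategory.tensorHom_comp_tensorHom_assoc,
      MonoidalCategory.tensorHom_comp_tensorHom_assoc, Category.comp_id, Category.comp_id,
      quotπ_quotComp, quotπ_quotComp, ← whiskerRight_comp_tensorHom,
      ← whiskerLeft_comp_tensorHom, Category.assoc, Category.assoc, quotπ_quotComp,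
      quotπ_quotComp, e_assoc_assoc]
  have h₁ := epi_whiskerLeft (quotπ r c d) (b ⟶[V] c)
  have h₂ := epi_whiskerRight (quotπ r b c) (quotHom r c d)
  have h₃ : Epi (quotπ r b c ⊗ₘ quotπ r c d) := by
    rw [MonoidalCategory.tensorHom_def']; exact epi_comp _ _
  have h₄ := epi_whiskerLeft (quotπ r b c ⊗ₘ quotπ r c d) (a ⟶[V] b)
  have h₅ := epi_whiskerRight (quotπ r a b) (quotHom r b c ⊗ quotHom r c d)
  have h₆ : Epi (quotπ r a b ⊗ₘ (quotπ r b c ⊗ₘ quotπ r c d)) := by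
    rw [MonoidalCategory.tensorHom_def' (quotπ r a b)]; exact epi_comp _ _
  exact (cancel_epi _).1 key

/-- The quotient of a `V`-category by a family of relations: it has the same objects, and its
hom-object from `a` to `b` is the coequalizer of the two morphisms
`∐ i, C(a, src i) ⊗ (obj i ⊗ C(tgt i, b)) ⟶ C(a, b)` given by inserting the two sides of the
relations and composing. -/
def QuotVCat (_r : I → VRel V C) : Type u := C

noncomputable instance quotEnriched : EnrichedCategory V (QuotVCat r) where
  Hom a b := quotHom (C := C) r a b
  id a := eId V (C := C) a ≫ quotπ (C := C) r a a
  comp a b c := quotComp (C := C) r a b c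
  id_comp a b := quot_id_comp (C := C) r a b
  comp_id a b := quot_comp_id (C := C) r a b
  assoc a b c d := quot_assoc (C := C) r a b c d

end Quotient
end Presentations

/-! ### The enriched Tambara relative tensor product -/

section Tambara

variable {V : Type v} [Category.{u} V] [MonoidalCategory V] [SymmetricCategory V]
  {A M N : Type u} [EnrichedCategory V A] [EnrichedCategory V M] [EnrichedCategory V N]
  {𝒜 : MonoidalVCat V A} (R : RightModule 𝒜 M) (L : LeftModule 𝒜 N)

/-- The index set of the coproduct `Ω(x, y)`, for objects `x` and `y` of `M × N`: one element
`hom`, one element `iota m a n` for every `a` with `x = (m ◁ a, n)` and `y = (m, a ▷ n)`, and one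
element `iotaInv m a n` for every `a` with `x = (m, a ▷ n)` and `y = (m ◁ a, n)`. -/
inductive TambaraEdge : M × N → M × N → Type u
  | hom (x y : M × N) : TambaraEdge x y
  | iota (m : M) (a : A) (n : N) : TambaraEdge (R.act.obj (m, a), n) (m, L.act.obj (a, n))
  | iotaInv (m : M) (a : A) (n : N) : TambaraEdge (m, L.act.obj (a, n)) (R.act.obj (m, a), n)

/-- The summands of `Ω(x, y)`. -/
def TambaraEdge.obj : ∀ {x y : M × N}, TambaraEdge R L x y → V
  | _, _, hom x y => x ⟶[V] y
  | _, _, iota _ _ _ => 𝟙_ V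
  | _, _, iotaInv _ _ _ => 𝟙_ V

variable [MonoidalClosed V] [HasColimits V]

/-- The `V`-graph `Ω` on the objects of `M × N`:
`Ω(x, y) = (M × N)(x, y) ⊔ ∐_{a : x = (m ◁ a, n), y = (m, a ▷ n)} 𝟙_ V ⊔
∐_{a : x = (m, a ▷ n), y = (m ◁ a, n)} 𝟙_ V`. -/
noncomputable def tambaraGraph (x y : M × N) : V :=
  ∐ fun e : TambaraEdge R L x y => e.obj

/-- The free `V`-category on `Ω`. -/
abbrev TambaraFree : Type u := FreeVCat (tambaraGraph R L)

namespace TambaraFree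

/-- The canonical morphism from a summand of `Ω(x, y)` to the hom-object of the free
`V`-category. -/
noncomputable def edge {x y : M × N} (e : TambaraEdge R L x y) :
    e.obj ⟶ (FreeVCat.of (tambaraGraph R L) x ⟶[V] FreeVCat.of (tambaraGraph R L) y) :=
  Sigma.ι (fun e : TambaraEdge R L x y => e.obj) e ≫ FreeVCat.gen (tambaraGraph R L) x y

/-- The canonical morphism from the hom-objects of `M × N`. -/
noncomputable def incl (x y : M × N) :
    (x ⟶[V] y) ⟶ (FreeVCat.of (tambaraGraph R L) x ⟶[V] FreeVCat.of (tambaraGraph R L) y) :=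
  edge R L (TambaraEdge.hom x y)

/-- The morphism of the free `V`-category given by a morphism of `M × N`. -/
noncomputable def inclHom {x y : M × N} (f : UHom V x y) :
    UHom V (FreeVCat.of (tambaraGraph R L) x) (FreeVCat.of (tambaraGraph R L) y) :=
  uOf (uTo f ≫ incl R L x y)

/-- The generator `ι : (m ◁ a, n) ⟶ (m, a ▷ n)`. -/
noncomputable def iota (m : M) (a : A) (n : N) :
    UHom V (FreeVCat.of (tambaraGraph R L) (R.act.obj (m, a), n))
      (FreeVCat.of (tambaraGraph R L) (m, L.act.obj (a, n))) :=
  uOf (edge R L (TambaraEdge.iota m a n))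

/-- The generator `ι⁻¹ : (m, a ▷ n) ⟶ (m ◁ a, n)`. -/
noncomputable def iotaInv (m : M) (a : A) (n : N) :
    UHom V (FreeVCat.of (tambaraGraph R L) (m, L.act.obj (a, n)))
      (FreeVCat.of (tambaraGraph R L) (R.act.obj (m, a), n)) :=
  uOf (edge R L (TambaraEdge.iotaInv m a n))

end TambaraFree

/-- The index set of the defining relations. -/
inductive TambaraIndex (M A N : Type u) : Type u
  | comp (x y z : M × N)
  | id (x : M × N)
  | isoLeft (m : M) (a : A) (n : N)
  | isoRight (m : M) (a : A) (n : N)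
  | naturality (x y : M × A × N)
  | associator (m : M) (a b : A) (n : N)
  | unitor (m : M) (n : N)

/-- An equation between two morphisms of the underlying category, as a relation. -/
def VRel.ofHom {C : Type u} [EnrichedCategory V C] {X Y : C} (f g : UHom V X Y) : VRel V C :=
  ⟨X, Y, 𝟙_ V, uTo f, uTo g⟩

open TambaraFree in
/-- The defining relations: the morphisms of `M × N` are composed as in `M × N`; `ι` and `ι⁻¹` are
mutually inverse; `ι` is natural, i.e. the two morphisms
`M(m, m') ⊗ A(a, a') ⊗ N(n, n') ⟶ Free(Ω)((m ◁ a, n), (m', a' ▷ n'))`, given by the action on `M`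
followed by composition with `ι` at `(m', a', n')` and by the action on `N` preceded by `ι` at
`(m, a, n)`, are identified; and `ι` is compatible with associators and unitors. -/
noncomputable def tambaraRel : TambaraIndex M A N → VRel V (TambaraFree R L)
  | .comp x y z =>
    { src := FreeVCat.of (tambaraGraph R L) x
      tgt := FreeVCat.of (tambaraGraph R L) z
      obj := (x ⟶[V] y) ⊗ (y ⟶[V] z)
      lhs := eComp V x y z ≫ incl R L x z
      rhs := (incl R L x y ⊗ₘ incl R L y z) ≫ eComp V (FreeVCat.of (tambaraGraph R L) x)
        (FreeVCat.of (tambaraGraph R L) y) (FreeVCat.of (tambaraGraph R L) z) }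
  | .id x => .ofHom (inclHom R L (uId x)) (uId (FreeVCat.of (tambaraGraph R L) x))
  | .isoLeft m a n => .ofHom (iota R L m a n ≫ iotaInv R L m a n)
      (uId (FreeVCat.of (tambaraGraph R L) (R.act.obj (m, a), n)))
  | .isoRight m a n => .ofHom (iotaInv R L m a n ≫ iota R L m a n)
      (uId (FreeVCat.of (tambaraGraph R L) (m, L.act.obj (a, n))))
  | .naturality (m, a, n) (m', a', n') =>
    { src := FreeVCat.of (tambaraGraph R L) (R.act.obj (m, a), n)
      tgt := FreeVCat.of (tambaraGraph R L) (m', L.act.obj (a', n'))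
      obj := (m ⟶[V] m') ⊗ ((a ⟶[V] a') ⊗ (n ⟶[V] n'))
      lhs := (actRight R N).map (m, a, n) (m', a', n') ≫ incl R L _ _ ≫
        postcomp _ (iota R L m' a' n')
      rhs := (actLeft L M).map (m, a, n) (m', a', n') ≫ incl R L _ _ ≫
        precomp (iota R L m a n) _ }
  | .associator m a b n => .ofHom
      (iota R L (R.act.obj (m, a)) b n ≫ iota R L m a (L.act.obj (b, n)) ≫
        inclHom R L (pairHom (uId m) (natApp L.assoc.hom (a, b, n))))
      (inclHom R L (pairHom (natApp R.assoc.hom (m, a, b)) (uId n)) ≫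
        iota R L m (𝒜.tensor.obj (a, b)) n)
  | .unitor m n => .ofHom
      (iota R L m 𝒜.unit n ≫ inclHom R L (pairHom (uId m) (natApp L.unitor.hom n)))
      (inclHom R L (pairHom (natApp R.unitor.hom m) (uId n)))

/-- The enriched Tambara relative tensor product of `M` and `N` over the monoidal `V`-category `A`:
the quotient of the free `V`-category on `Ω` by the defining relations. -/
abbrev Tambara : Type u := QuotVCat (tambaraRel R L)

end Tambara

end VEnr

open VEnr

-- Functors out of the relative tensor product and cocones on the bar construction classify the same
-- data. Up to isomorphism a cocone is determined by `S = σ_C` and by `θ = σ_{F₁} σ_{F₀}⁻¹ : S F₀ ≅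
-- S F₁` (`theta`): `σ_B` is isomorphic to `S F₀`, `σ_A` to `S F₀ G₀`, and the conditions on `κ₂`
-- and `κ₁` express `σ_{G₁}` and `σ_{G₂}` through `σ_{G₀}` and the `σ_{F_i}`. One equation between
-- `θ` and the `κ_i` remains (`theta_rel`, conversely `ofBalanced`); for the bar construction it
-- says that `θ : S(m ◁ a, n) ≅ S(m, a ▷ n)` is compatible with associators (`bar_balanced_iff`).
-- Likewise a morphism of cocones amounts to a transformation of the `σ_C` that commutes with `θ`
-- (`homOfC`, `Hom.ext_hC`).
--
-- On the other side, by its presentation, a functor out of `M ×_A N` amounts to a functor `S` on `M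
-- × N` with a natural isomorphism `θ` compatible with associators and with unitors. Since `V` is
-- closed, `⊗` preserves colimits in each variable, so functors and naturality conditions can be
-- described on generators (`Tambara.lift`, `Tambara.natural`).
--
-- The gap is the unitor relation, which no arrow of the truncated bar construction encodes. It is
-- automatic (`balanced_unitor`): as `θ` is invertible, the associator condition for `(m, a, 1, n)`
-- yields the unitor condition at `m ◁ a`, and the case `a = 1` is transported along `m ◁ 1 ≅ m`.
-- This uses that `β_{m,a,1}` followed by `m ◁ ρ_a` is the unit isomorphism of `m ◁ a`, which
-- follows from pentagon and triangles as in Kelly's reduction of the axioms of a monoidal category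
-- (`assocHom_rightUnitor`).
--
-- So composition with the cocone given by the canonical functor and `ι` is fully faithful and
-- essentially surjective (`cocone_isBicolimit`); the second claim is uniqueness of bicolimits
-- (`IsBicolimit.vEquivalent`).

namespace VEnr

-- Morphisms of cocones and uniqueness of bicolimits.

section CoconeMorphisms

/-- The cocone condition `r` determines `g₁` from `g₀`, `f₀`, `f₁` and `k`, because `f₁` is
invertible in a cocone. Compatibility with `g₁` is therefore inherited from the other four squares.
This makes the conditions for `G₁` and `G₂` on a morphism of cocones redundant. -/
lemma cocone_square {𝒞 : Type*} [Category 𝒞] {a b₀ b₁ c₀ c₁ a' b₀' b₁' c₀' c₁' : 𝒞}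
    {g₀ : a ⟶ b₀} {g₁ : a ⟶ b₁} {f₀ : b₀ ⟶ c₀} {f₁ : b₁ ⟶ c₁} {k : c₀ ⟶ c₁}
    {g₀' : a' ⟶ b₀'} {g₁' : a' ⟶ b₁'} {f₀' : b₀' ⟶ c₀'} {f₁' : b₁' ⟶ c₁'} {k' : c₀' ⟶ c₁'}
    {hA : a ⟶ a'} {hB₀ : b₀ ⟶ b₀'} {hB₁ : b₁ ⟶ b₁'} {hC₀ : c₀ ⟶ c₀'} {hC₁ : c₁ ⟶ c₁'}
    (r : (g₀ ≫ f₀) ≫ k = g₁ ≫ f₁) (r' : (g₀' ≫ f₀') ≫ k' = g₁' ≫ f₁')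
    (hk : k ≫ hC₁ = hC₀ ≫ k') (h₀ : f₀ ≫ hC₀ = hB₀ ≫ f₀') (h₁ : f₁ ≫ hC₁ = hB₁ ≫ f₁')
    (hg : g₀ ≫ hB₀ = hA ≫ g₀') [Mono f₁'] : g₁ ≫ hB₁ = hA ≫ g₁' := by
  rw [← cancel_mono f₁', Category.assoc, Category.assoc, ← h₁, ← r', ← Category.assoc, ← r]
  simp only [Category.assoc, hk]
  rw [reassoc_of% h₀, reassoc_of% hg]

lemma inv_comp_comm {𝒞 : Type*} [Category 𝒞] {a b a' b' : 𝒞} (i : a ≅ a') (j : b ≅ b')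
    {f : a ⟶ b} {f' : a' ⟶ b'} (h : f ≫ j.hom = i.hom ≫ f') : f' ≫ j.inv = i.inv ≫ f := by
  rw [Iso.comp_inv_eq, Category.assoc, Iso.eq_inv_comp, h]

variable {V : Type v} [Category.{u} V] [MonoidalCategory V]
variable {A B C D E P : Type u} [EnrichedCategory V A] [EnrichedCategory V B]
  [EnrichedCategory V C] [EnrichedCategory V D] [EnrichedCategory V E] [EnrichedCategory V P]

/-- The component of a `V`-natural isomorphism. -/
def natIsoApp {F G : VFun V C D} (α : F ≅ G) (X : C) :
    ForgetEnrichment.of V (F.obj X) ≅ ForgetEnrichment.of V (G.obj X) where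
  hom := natApp α.hom X
  inv := natApp α.inv X
  hom_inv_id := congrArg (fun β => natApp β X) α.hom_inv_id
  inv_hom_id := congrArg (fun β => natApp β X) α.inv_hom_id

instance {F G : VFun V C D} (α : F ⟶ G) [IsIso α] (X : C) : IsIso (natApp α X) :=
  inferInstanceAs (IsIso (natIsoApp (asIso α) X).hom)

/-- Postcomposition with an isomorphism is injective. -/
lemma postcomp_injective {W : V} {X Y Z : C} (g : UHom V Y Z) [IsIso g] {p q : W ⟶ (X ⟶[V] Y)}
    (h : p ≫ postcomp X g = q ≫ postcomp X g) : p = q := by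
  have e : postcomp X g ≫ postcomp X (inv g) = 𝟙 _ :=
    (postcomp_comp X g (inv g)).symm.trans
      ((congrArg (postcomp X) (IsIso.hom_inv_id g)).trans (postcomp_id X Y))
  have := congrArg (· ≫ postcomp X (inv g)) h
  simpa only [Category.assoc, e, Category.comp_id] using this

/-- Precomposition with an isomorphism is injective. -/
lemma precomp_injective {W : V} {X Y Z : C} (f : UHom V X Y) [IsIso f] {p q : W ⟶ (Y ⟶[V] Z)}
    (h : p ≫ precomp f Z = q ≫ precomp f Z) : p = q := by
  have e : precomp f Z ≫ precomp (inv f) Z = 𝟙 _ :=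
    (precomp_comp (inv f) f Z).symm.trans
      ((congrArg (precomp · Z) (IsIso.inv_hom_id f)).trans (precomp_id Y Z))
  have := congrArg (· ≫ precomp (inv f) Z) h
  simpa only [Category.assoc, e, Category.comp_id] using this

/-- Gives naturality of identity components between two functors that agree on objects and whose
maps of hom-objects are equal, though not by definition; the coherence isomorphisms below all arise
in this way. -/
lemma comp_uId_comm {W : V} {X Y : C} {p q : W ⟶ (X ⟶[V] Y)} (h : p = q) :
    p ≫ postcomp X (uId Y) = q ≫ precomp (uId X) Y := by
  rw [precomp_id, postcomp_id, h]

/-- A `V`-natural transformation with invertible components is an isomorphism. -/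
noncomputable def natIsoOfIsIso {F G : VFun V C D} (α : F ⟶ G) (h : ∀ X, IsIso (natApp α X)) :
    F ≅ G where
  hom := α
  inv := VNatTrans.mk (fun X => inv (natApp α X)) (fun X Y => by
    -- Composing with the invertible `α_Y` and `α_X` loses nothing and turns the square for the
    -- inverses into the square for `α`.
    apply postcomp_injective (natApp α Y)
    apply precomp_injective (natApp α X)
    have e₁ : postcomp (G.obj X) (inv (natApp α Y)) ≫ postcomp (G.obj X) (natApp α Y) = 𝟙 _ :=
      (postcomp_comp _ _ _).symm.trans
        ((congrArg (postcomp _) (IsIso.inv_hom_id _)).trans (postcomp_id _ _))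
    have e₂ : precomp (inv (natApp α X)) (F.obj Y) ≫ precomp (natApp α X) (F.obj Y) = 𝟙 _ :=
      (precomp_comp _ _ _).symm.trans
        ((congrArg (precomp · _) (IsIso.hom_inv_id _)).trans (precomp_id _ _))
    simp only [Category.assoc]
    rw [reassoc_of% e₁, ← precomp_postcomp, reassoc_of% e₂]
    exact (α.naturality X Y).symm)
  hom_inv_id := nat_ext fun X => IsIso.hom_inv_id (natApp α X)
  inv_hom_id := nat_ext fun X => IsIso.inv_hom_id (natApp α X)

namespace BarCocone

variable {X : BarShape V A B C}

/-- The isomorphism `σ_C ∘ F₀ ≅ σ_C ∘ F₁` given by a cocone. -/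
def theta (σ : BarCocone X E) : X.F₀.comp σ.sC ≅ X.F₁.comp σ.sC := σ.sF₀.symm ≪≫ σ.sF₁

lemma sF₀_theta (σ : BarCocone X E) (b : B) :
    natApp σ.sF₀.hom b ≫ natApp σ.theta.hom b = natApp σ.sF₁.hom b :=
  (natIsoApp σ.sF₀ b).hom_inv_id_assoc _

/-- A morphism of cocones is compatible with the isomorphisms `σ_C ∘ F₀ ≅ σ_C ∘ F₁`. -/
lemma Hom.theta_comm {σ τ : BarCocone X E} (f : σ ⟶ τ) (b : B) :
    natApp σ.theta.hom b ≫ natApp f.hC (X.F₁.obj b) =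
      natApp f.hC (X.F₀.obj b) ≫ natApp τ.theta.hom b := by
  have h₀ : natApp σ.sF₀.hom b ≫ natApp f.hC (X.F₀.obj b) = natApp f.hB b ≫ natApp τ.sF₀.hom b :=
    congrArg (fun β => natApp β b) f.compF₀
  have h₁ : natApp σ.sF₁.hom b ≫ natApp f.hC (X.F₁.obj b) = natApp f.hB b ≫ natApp τ.sF₁.hom b :=
    congrArg (fun β => natApp β b) f.compF₁
  rw [← cancel_epi (natApp σ.sF₀.hom b)]
  refine (Category.assoc _ _ _).symm.trans ?_
  refine (congrArg (· ≫ _) (σ.sF₀_theta b)).trans (h₁.trans ?_)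
  refine Eq.trans ?_ (Category.assoc _ _ _)
  refine Eq.trans ?_ (congrArg (· ≫ _) h₀).symm
  exact ((Category.assoc _ _ _).trans (congrArg (_ ≫ ·) (τ.sF₀_theta b))).symm

/-- A morphism of cocones is determined by its component at `C`. -/
lemma Hom.ext_hC {σ τ : BarCocone X E} {f g : σ ⟶ τ} (h : f.hC = g.hC) : f = g := by
  have hB : f.hB = g.hB := by
    rw [← cancel_mono τ.sF₀.hom, ← f.compF₀, ← g.compF₀, h]
  have hA : f.hA = g.hA := by
    rw [← cancel_mono τ.sG₀.hom, ← f.compG₀, ← g.compG₀, hB]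
  exact BarCocone.Hom.ext hA hB h

/-- The morphism of cocones with a given component at `C`. -/
def homOfC {σ τ : BarCocone X E} (hC : σ.sC ⟶ τ.sC)
    (h : ∀ b, natApp σ.theta.hom b ≫ natApp hC (X.F₁.obj b) =
      natApp hC (X.F₀.obj b) ≫ natApp τ.theta.hom b) : σ ⟶ τ :=
  -- `hB` and `hA` are forced by the conditions for `F₀` and `G₀`. The hypothesis on `θ` is then the
  -- condition for `F₁`, while `κ₂` and `κ₁` give those for `G₁` and `G₂`.
  let hB : σ.sB ⟶ τ.sB := σ.sF₀.hom ≫ VFun.whiskerL X.F₀ hC ≫ τ.sF₀.inv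
  let hA : σ.sA ⟶ τ.sA := σ.sG₀.hom ≫ VFun.whiskerL X.G₀ hB ≫ τ.sG₀.inv
  have hF₀ : σ.sF₀.hom ≫ VFun.whiskerL X.F₀ hC = hB ≫ τ.sF₀.hom := by simp [hB]
  have hF₁ : σ.sF₁.hom ≫ VFun.whiskerL X.F₁ hC = hB ≫ τ.sF₁.hom := by
    have e : σ.theta.hom ≫ VFun.whiskerL X.F₁ hC = VFun.whiskerL X.F₀ hC ≫ τ.theta.hom :=
      nat_ext h
    simp only [theta, Iso.trans_hom, Iso.symm_hom, Category.assoc, Iso.inv_comp_eq] at e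
    simp only [hB, Category.assoc, e]
  have hG₀ : σ.sG₀.hom ≫ VFun.whiskerL X.G₀ hB = hA ≫ τ.sG₀.hom := by simp [hA]
  have cG₀ (a : A) := congrArg (fun β => natApp β a) hG₀
  have cF₀ (b : B) := congrArg (fun β => natApp β b) hF₀
  have cF₁ (b : B) := congrArg (fun β => natApp β b) hF₁
  { hA := hA, hB := hB, hC := hC
    compG₀ := hG₀
    compG₁ := nat_ext fun a => cocone_square (σ.rel₂ a) (τ.rel₂ a)
      (hC.naturality_hom (natApp X.κ₂ a)) (cF₀ _) (cF₀ _) (cG₀ a)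
    compG₂ := nat_ext fun a => cocone_square (σ.rel₁ a) (τ.rel₁ a)
      (hC.naturality_hom (natApp X.κ₁ a)) (cF₁ _) (cF₀ _) (cG₀ a)
    compF₀ := hF₀
    compF₁ := hF₁ }

/-- The isomorphism of cocones with a given component at `C`. -/
def isoOfC {σ τ : BarCocone X E} (e : σ.sC ≅ τ.sC)
    (h : ∀ b, natApp σ.theta.hom b ≫ natApp e.hom (X.F₁.obj b) =
      natApp e.hom (X.F₀.obj b) ≫ natApp τ.theta.hom b) : σ ≅ τ where
  hom := homOfC e.hom h
  inv := homOfC e.inv fun b => by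
    exact inv_comp_comm (natIsoApp e (X.F₀.obj b)) (natIsoApp e (X.F₁.obj b)) (h b)
  hom_inv_id := Hom.ext_hC e.hom_inv_id
  inv_hom_id := Hom.ext_hC e.inv_hom_id

/-- The morphism of cocones obtained by composing with a `V`-functor. -/
def pushMap {σ τ : BarCocone X P} (f : σ ⟶ τ) (H : VFun V P E) : σ.push H ⟶ τ.push H :=
  homOfC (VFun.whiskerR f.hC H) fun b => by
    have h := congrArg H.mapHom (f.theta_comm b)
    -- Forming `θ` commutes with composing by `H`, so the required square is the image under `H` of
    -- the one for `f`.
    have e (σ : BarCocone X P) :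
        natApp (σ.push H).theta.hom b = H.mapHom (natApp σ.theta.hom b) :=
      (H.mapHom_comp _ _).symm
    rw [H.mapHom_comp, H.mapHom_comp] at h
    rw [e, e]
    exact h

/-- Composition with a `V`-functor preserves isomorphisms of cocones. -/
def pushIso {σ τ : BarCocone X P} (e : σ ≅ τ) (H : VFun V P E) : σ.push H ≅ τ.push H where
  hom := pushMap e.hom H
  inv := pushMap e.inv H
  hom_inv_id := Hom.ext_hC (nat_ext fun x => by
    have h := congrArg (fun β : σ ⟶ σ => natApp β.hC x) e.hom_inv_id
    exact (H.mapHom_comp _ _).symm.trans ((congrArg H.mapHom h).trans (H.mapHom_id _)))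
  inv_hom_id := Hom.ext_hC (nat_ext fun x => by
    have h := congrArg (fun β : τ ⟶ τ => natApp β.hC x) e.inv_hom_id
    exact (H.mapHom_comp _ _).symm.trans ((congrArg H.mapHom h).trans (H.mapHom_id _)))

/-- Composing with a composite of `V`-functors. -/
def pushComp (σ : BarCocone X P) (H : VFun V P E) (K : VFun V E D) :
    σ.push (H.comp K) ≅ (σ.push H).push K :=
  isoOfC
    { hom := VNatTrans.mk (fun x => uId _) (fun x y => comp_uId_comm (Category.assoc _ _ _).symm)
      inv := VNatTrans.mk (fun x => uId _) (fun x y => comp_uId_comm (Category.assoc _ _ _))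
      hom_inv_id := nat_ext fun x => Category.comp_id _
      inv_hom_id := nat_ext fun x => Category.comp_id _ }
    fun b => by
      have e₁ : natApp (σ.push (H.comp K)).theta.hom b =
          (H.comp K).mapHom (natApp σ.theta.hom b) := ((H.comp K).mapHom_comp _ _).symm
      have e₂ : natApp ((σ.push H).push K).theta.hom b =
          K.mapHom (H.mapHom (natApp σ.theta.hom b)) :=
        (K.mapHom_comp _ _).symm.trans (congrArg K.mapHom (H.mapHom_comp _ _).symm)
      refine (Category.comp_id _).trans (Eq.trans ?_ (Category.id_comp _).symm)
      exact e₁.trans ((VFun.comp_mapHom H K _).trans e₂.symm)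

/-- Composing with the identity `V`-functor. -/
def pushId (σ : BarCocone X P) : σ.push (VFun.id V P) ≅ σ :=
  isoOfC
    { hom := VNatTrans.mk (fun x => uId _) (fun x y => comp_uId_comm (Category.comp_id _))
      inv := VNatTrans.mk (fun x => uId _) (fun x y => comp_uId_comm (Category.comp_id _).symm)
      hom_inv_id := nat_ext fun x => Category.comp_id _
      inv_hom_id := nat_ext fun x => Category.comp_id _ }
    fun b => by
      have e₁ : natApp (σ.push (VFun.id V P)).theta.hom b =
          (VFun.id V P).mapHom (natApp σ.theta.hom b) := ((VFun.id V P).mapHom_comp _ _).symm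
      refine (Category.comp_id _).trans (Eq.trans ?_ (Category.id_comp _).symm)
      exact e₁.trans (Category.comp_id _)

/-- Bicolimits are unique up to equivalence of `V`-categories. -/
theorem IsBicolimit.vEquivalent {σ : BarCocone X P} {τ : BarCocone X E} (hσ : σ.IsBicolimit)
    (hτ : τ.IsBicolimit) : VEquivalent V P E := by
  have := hσ E
  have := hσ P
  have := hτ P
  have := hτ E
  -- Essential surjectivity supplies the comparison functors. Both `F.comp G` and the identity carry
  -- `σ` to a cocone isomorphic to `σ`, so full faithfulness lifts this to an isomorphism of
  -- functors; symmetrically for `G.comp F`.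
  let F := (σ.pushFunctor E).objPreimage τ
  let G := (τ.pushFunctor P).objPreimage σ
  let i : σ.push F ≅ τ := (σ.pushFunctor E).objObjPreimageIso τ
  let j : τ.push G ≅ σ := (τ.pushFunctor P).objObjPreimageIso σ
  exact ⟨F, G,
    ⟨(σ.pushFunctor P).preimageIso
      (σ.pushComp F G ≪≫ pushIso i G ≪≫ j ≪≫ σ.pushId.symm)⟩,
    ⟨(τ.pushFunctor E).preimageIso
      (τ.pushComp G F ≪≫ pushIso j F ≪≫ i ≪≫ τ.pushId.symm)⟩⟩

end BarCocone
end CoconeMorphisms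

-- Naturality as a condition on single morphisms into hom-objects.

section Naturality

variable {V : Type v} [Category.{u} V] [MonoidalCategory V]
variable {C E : Type u} [EnrichedCategory V C] [EnrichedCategory V E]

lemma VFun.id_mapHom {X Y : C} (f : UHom V X Y) : (VFun.id V C).mapHom f = f := Category.comp_id _

/-- Associativity of composition with the last of three factors fixed; the next two lemmas fix the
first and the middle factor. -/
lemma eComp_postcomp (W X : C) {Y Z : C} (g : UHom V Y Z) :
    eComp V W X Y ≫ postcomp W g = (W ⟶[V] X) ◁ postcomp X g ≫ eComp V W X Z := by
  unfold postcomp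
  rw [rightUnitor_inv_naturality_assoc, ← whisker_exchange_assoc, ← e_assoc' V W X Y Z]
  simp only [MonoidalCategory.whiskerLeft_comp, Category.assoc]
  monoidal

lemma eComp_precomp {W X : C} (f : UHom V W X) (Y Z : C) :
    eComp V X Y Z ≫ precomp f Z = precomp f Y ▷ (Y ⟶[V] Z) ≫ eComp V W Y Z := by
  unfold precomp
  rw [leftUnitor_inv_naturality_assoc, whisker_exchange_assoc, ← e_assoc V W X Y Z]
  simp only [comp_whiskerRight, Category.assoc]
  monoidal

lemma postcomp_whiskerRight_eComp (W : C) {X Y : C} (g : UHom V X Y) (Z : C) :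
    postcomp W g ▷ (Y ⟶[V] Z) ≫ eComp V W Y Z =
      (W ⟶[V] X) ◁ precomp g Z ≫ eComp V W X Z := by
  unfold postcomp precomp
  simp only [comp_whiskerRight, MonoidalCategory.whiskerLeft_comp, Category.assoc]
  rw [← e_assoc' V W X Y Z]
  monoidal

/-- The naturality condition for a family of components `F X ⟶ G X`, restricted along
`p : W ⟶ C(X, Y)`. -/
def NaturalAt (F G : VFun V C E) (app : ∀ X : C, UHom V (F.obj X) (G.obj X)) {W : V} {X Y : C}
    (p : W ⟶ (X ⟶[V] Y)) : Prop :=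
  p ≫ F.map X Y ≫ postcomp (F.obj X) (app Y) = p ≫ G.map X Y ≫ precomp (app X) (G.obj Y)

namespace NaturalAt

variable {F G : VFun V C E} {app : ∀ X : C, UHom V (F.obj X) (G.obj X)}

lemma eId (X : C) : NaturalAt F G app (eId V X) := by
  unfold NaturalAt
  have h₁ := uTo_postcomp (uId (V := V) (F.obj X)) (app X)
  have h₂ := uTo_precomp (app X) (uId (V := V) (G.obj X))
  rw [uTo_id] at h₁ h₂
  rw [← Category.assoc, ← Category.assoc, F.map_id, G.map_id, h₁, h₂]
  exact congrArg uTo ((Category.id_comp (app X)).trans (Category.comp_id (app X)).symm)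

/-- Two naturality squares are pasted along `app Y`: `hq` moves the component from `Z` to `Y`,
associativity with middle factor `app Y` passes it to the other side, and `hp` moves it to `X`.
Hence naturality propagates from generators to composites. -/
lemma comp {X Y Z : C} {W W' : V} {p : W ⟶ (X ⟶[V] Y)} {q : W' ⟶ (Y ⟶[V] Z)}
    (hp : NaturalAt F G app p) (hq : NaturalAt F G app q) :
    NaturalAt F G app ((p ⊗ₘ q) ≫ eComp V X Y Z) := by
  unfold NaturalAt at *
  have e₁ : eComp V X Y Z ≫ F.map X Z ≫ postcomp (F.obj X) (app Z) =
      (F.map X Y ⊗ₘ (F.map Y Z ≫ postcomp (F.obj Y) (app Z))) ≫ eComp V _ _ _ := by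
    rw [← Category.assoc, F.map_comp, Category.assoc, eComp_postcomp, ← Category.assoc,
      tensorHom_comp_whiskerLeft]
  have e₂ : eComp V X Y Z ≫ G.map X Z ≫ precomp (app X) (G.obj Z) =
      ((G.map X Y ≫ precomp (app X) (G.obj Y)) ⊗ₘ G.map Y Z) ≫ eComp V _ _ _ := by
    rw [← Category.assoc, G.map_comp, Category.assoc, eComp_precomp, ← Category.assoc,
      tensorHom_comp_whiskerRight]
  rw [Category.assoc, Category.assoc, e₁, e₂, ← Category.assoc, ← Category.assoc,
    MonoidalCategory.tensorHom_comp_tensorHom, MonoidalCategory.tensorHom_comp_tensorHom, hq, ← hp]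
  have k := congrArg (((p ≫ F.map X Y) ⊗ₘ (q ≫ G.map Y Z)) ≫ ·)
    (postcomp_whiskerRight_eComp (F.obj X) (app Y) (G.obj Z))
  rw [← Category.assoc, ← Category.assoc, tensorHom_comp_whiskerRight,
    tensorHom_comp_whiskerLeft, Category.assoc p, Category.assoc q] at k
  exact k.symm

/-- For a single morphism of the underlying category the condition is the ordinary naturality
square. This serves for `ι` and `ι⁻¹`, whose summands in `Ω` are copies of the unit object. -/
lemma of_hom {X Y : C} {f : UHom V X Y} (h : F.mapHom f ≫ app Y = app X ≫ G.mapHom f) :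
    NaturalAt F G app (uTo f) := by
  unfold NaturalAt
  rw [← Category.assoc, ← Category.assoc]
  exact (uTo_postcomp (F.mapHom f) (app Y)).trans
    ((congrArg uTo h).trans (uTo_precomp (app X) (G.mapHom f)).symm)

end NaturalAt
end Naturality

-- The universal property of free `V`-categories.

section FreeUniversal

variable {V : Type v} [Category.{u} V] [MonoidalCategory V]

section

variable {S : Type u} {E : Type u} [EnrichedCategory V E] {Ω : S → S → V} {φ : S → E}

/-- The evaluation of paths in a `V`-category. -/
def Word.eval (f : ∀ A B : S, Ω A B ⟶ (φ A ⟶[V] φ B)) :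
    ∀ {A B : S} (w : Word A B), w.obj Ω ⟶ (φ A ⟶[V] φ B)
  | _, _, .nil A => eId V (φ A)
  | _, B, @Word.cons _ A X _ w => (f A X ⊗ₘ Word.eval f w) ≫ eComp V (φ A) (φ X) (φ B)

/-- Induction on the first word: the empty word is the left unit law of `E`, a further step is
associativity. This is functoriality of the extension to the free `V`-category, one pair of words at
a time. -/
lemma Word.mul_eval (f : ∀ A B : S, Ω A B ⟶ (φ A ⟶[V] φ B)) :
    ∀ {A B C : S} (w : Word A B) (w' : Word B C),
      Word.mul Ω w w' ≫ (w.append w').eval f = (w.eval f ⊗ₘ w'.eval f) ≫ eComp V (φ A) (φ B) (φ C)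
  | _, _, _, .nil A, w' => by
    show (λ_ (w'.obj Ω)).hom ≫ w'.eval f = (eId V (φ A) ⊗ₘ w'.eval f) ≫ _
    rw [MonoidalCategory.tensorHom_def', Category.assoc, eId_whisker_comp, leftUnitor_naturality]
  | _, B, D, @Word.cons _ A X _ w, w' => by
    show ((α_ (Ω A X) (w.obj Ω) (w'.obj Ω)).hom ≫ Ω A X ◁ Word.mul Ω w w') ≫
        (f A X ⊗ₘ (w.append w').eval f) ≫ eComp V (φ A) (φ X) (φ D) =
      (((f A X ⊗ₘ w.eval f) ≫ eComp V (φ A) (φ X) (φ B)) ⊗ₘ w'.eval f) ≫ _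
    rw [Category.assoc, whiskerLeft_comp_tensorHom_assoc, Word.mul_eval f w w',
      ← tensorHom_comp_whiskerLeft, ← tensorHom_comp_whiskerRight, Category.assoc, Category.assoc,
      ← e_assoc' V, associator_naturality_assoc]

end

variable [SymmetricCategory V] [MonoidalClosed V] [HasColimits V] {S : Type u}
  {E : Type u} [EnrichedCategory V E] {Ω : S → S → V}

/-- The `V`-functor out of a free `V`-category given by a morphism of `V`-graphs. -/
noncomputable def freeLift (φ : S → E) (f : ∀ A B : S, Ω A B ⟶ (φ A ⟶[V] φ B)) :
    VFun V (FreeVCat Ω) E where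
  obj A := φ A
  map A B := Sigma.desc fun w : Word (S := S) A B => w.eval f
  map_id A := Sigma.ι_desc (fun w : Word (S := S) A A => w.eval f) (Word.nil A)
  map_comp A B D := by
    -- Since `⊗` distributes over coproducts, the equation may be tested on each pair of words.
    refine sigma_ext_tensor fun w w' => ?_
    have h := ι_freeComp Ω w w'
    refine (Category.assoc _ _ _).symm.trans ((congrArg (· ≫ _) h).trans ?_)
    refine (Category.assoc _ _ _).trans ?_
    refine (congrArg (_ ≫ ·) (Sigma.ι_desc (fun w : Word (S := S) A D => w.eval f) _)).trans ?_
    refine (Word.mul_eval f w w').trans ?_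
    refine Eq.trans ?_ (Category.assoc _ _ _)
    refine congrArg (· ≫ _) (Eq.trans ?_ (MonoidalCategory.tensorHom_comp_tensorHom _ _ _ _).symm)
    exact congrArg₂ (· ⊗ₘ ·) (Sigma.ι_desc _ _).symm (Sigma.ι_desc _ _).symm

lemma gen_freeLift (φ : S → E) (f : ∀ A B : S, Ω A B ⟶ (φ A ⟶[V] φ B)) (A B : S) :
    FreeVCat.gen Ω A B ≫ (freeLift φ f).map A B = f A B := by
  unfold FreeVCat.gen
  refine (Category.assoc _ _ _).trans ?_
  refine (congrArg ((ρ_ (Ω A B)).inv ≫ ·)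
    (Sigma.ι_desc (fun w : Word (S := S) A B => w.eval f) _)).trans ?_
  -- A one-step word still ends with the empty word, so its value is `f` composed with an identity.
  show (ρ_ (Ω A B)).inv ≫ (f A B ⊗ₘ eId V (φ B)) ≫ eComp V (φ A) (φ B) (φ B) = f A B
  rw [MonoidalCategory.tensorHom_def, Category.assoc, whisker_eId_comp, rightUnitor_naturality,
    Iso.inv_hom_id_assoc]

/-- Concatenating a one-step word with `w` prepends a letter; the unit object left over from the
one-step word disappears by the triangle identity. This is the induction step for statements about
words. -/
lemma freeι_cons (A : S) {X B : S} (w : Word X B) :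
    freeι Ω (Word.cons A w) =
      (FreeVCat.gen Ω A X ⊗ₘ freeι Ω w) ≫
        eComp V (FreeVCat.of Ω A) (FreeVCat.of Ω X) (FreeVCat.of Ω B) := by
  have h := ι_freeComp Ω (Word.cons A (Word.nil X)) w
  refine Eq.symm ?_
  unfold FreeVCat.gen
  refine (congrArg (· ≫ _) (whiskerRight_comp_tensorHom (ρ_ (Ω A X)).inv
    (freeι Ω (Word.cons A (Word.nil X))) (freeι Ω w)).symm).trans ?_
  refine (Category.assoc _ _ _).trans ((congrArg (_ ≫ ·) h).trans ?_)
  have e : (ρ_ (Ω A X)).inv ▷ w.obj Ω ≫ (α_ (Ω A X) (𝟙_ V) (w.obj Ω)).hom ≫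
      Ω A X ◁ (λ_ (w.obj Ω)).hom = 𝟙 _ := by simp
  exact (Category.assoc _ _ _).symm.trans ((congrArg (· ≫ _) e).trans (Category.id_comp _))

/-- `V`-naturality of a family of components on a free `V`-category can be checked on the
generators. -/
lemma free_natural {F G : VFun V (FreeVCat Ω) E}
    {app : ∀ A : FreeVCat Ω, UHom V (F.obj A) (G.obj A)}
    (h : ∀ A B, NaturalAt F G app (FreeVCat.gen Ω A B)) (A B : FreeVCat Ω) :
    F.map A B ≫ postcomp (F.obj A) (app B) = G.map A B ≫ precomp (app A) (G.obj B) := by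
  -- The hom-object is the coproduct over words, so naturality is needed only on each summand, where
  -- it follows by induction from identities and composites.
  have key : ∀ {A B : S} (w : Word A B),
      NaturalAt F G app (X := FreeVCat.of Ω A) (Y := FreeVCat.of Ω B) (freeι Ω w) := by
    intro A B w
    induction w with
    | nil A => exact NaturalAt.eId (FreeVCat.of Ω A)
    | cons A w ih =>
      rw [freeι_cons]
      exact (h _ _).comp ih
  exact Sigma.hom_ext _ _ fun w => key w

end FreeUniversal

-- The universal property of quotients of `V`-categories.

section QuotientUniversal

variable {V : Type v} [Category.{u} V] [MonoidalCategory V]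
variable {C E : Type u} [EnrichedCategory V C] [EnrichedCategory V E]

/-- A functor preserves composites, so the image of an inserted morphism is the insertion of its
image. Consequently a functor that identifies the two sides of each relation coequalizes the whole
pair defining the quotient. -/
lemma sandwich_map (F : VFun V C E) {x y : C} {P : V} (f : P ⟶ (x ⟶[V] y)) (a b : C) :
    sandwich f a b ≫ F.map a b =
      (F.map a x ⊗ₘ (𝟙 P ⊗ₘ F.map y b)) ≫ sandwich (f ≫ F.map x y) (F.obj a) (F.obj b) := by
  unfold sandwich
  rw [Category.assoc, F.map_comp, whiskerLeft_comp_tensorHom_assoc, Category.assoc, F.map_comp,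
    whiskerRight_comp_tensorHom_assoc, tensorHom_comp_whiskerLeft_assoc,
    tensorHom_comp_whiskerRight_assoc, Category.id_comp]

/-- Inserting between identities recovers `f`. The coequalizer imposes the relations only in
composed form, and this extracts the relations themselves. -/
lemma eId_sandwich {x y : C} {P : V} (f : P ⟶ (x ⟶[V] y)) :
    (λ_ P).inv ≫ (eId V x ⊗ₘ ((ρ_ P).inv ≫ P ◁ eId V y)) ≫ sandwich f x y = f := by
  unfold sandwich
  rw [tensorHom_comp_whiskerLeft_assoc, Category.assoc, whisker_exchange_assoc, whisker_eId_comp,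
    MonoidalCategory.tensorHom_def', Category.assoc, eId_whisker_comp, rightUnitor_naturality,
    Iso.inv_hom_id_assoc, leftUnitor_naturality, Iso.inv_hom_id_assoc]

variable [HasColimits V] {I : Type u} (r : I → VRel V C)

lemma rel_quotπ (i : I) :
    (r i).lhs ≫ quotπ r (r i).src (r i).tgt = (r i).rhs ≫ quotπ r (r i).src (r i).tgt := by
  have h := sandwich_quotπ r i (r i).src (r i).tgt
  rw [← eId_sandwich (r i).lhs, ← eId_sandwich (r i).rhs]
  simp only [Category.assoc]
  rw [h]

variable {r} in
lemma rel_map (F : VFun V C E)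
    (h : ∀ i, (r i).lhs ≫ F.map (r i).src (r i).tgt = (r i).rhs ≫ F.map (r i).src (r i).tgt)
    (a b : C) : relL r a b ≫ F.map a b = relR r a b ≫ F.map a b := by
  refine Sigma.hom_ext _ _ fun i => ?_
  simp only [relL, relR, Sigma.ι_desc_assoc]
  rw [sandwich_map, sandwich_map, h]

variable [SymmetricCategory V] [MonoidalClosed V]

/-- The projection to a quotient. -/
noncomputable def quotProj : VFun V C (QuotVCat r) where
  obj a := a
  map a b := quotπ r a b
  map_id _ := rfl
  map_comp a b c := (quotπ_quotComp r a b c).symm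

/-- The `V`-functor out of a quotient induced by a `V`-functor that respects the relations. -/
noncomputable def quotLift (F : VFun V C E)
    (h : ∀ i, (r i).lhs ≫ F.map (r i).src (r i).tgt = (r i).rhs ≫ F.map (r i).src (r i).tgt) :
    VFun V (QuotVCat r) E where
  obj a := F.obj a
  map a b := coequalizer.desc (F.map a b) (rel_map F h a b)
  map_id a := by
    refine (Category.assoc _ _ _).trans ?_
    refine (congrArg (_ ≫ ·) (coequalizer.π_desc _ _)).trans (F.map_id a)
  map_comp a b c := by
    have h₁ (Z : V) := epi_whiskerLeft (quotπ (C := C) r b c) Z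
    have h₂ (Z : V) := epi_whiskerRight (quotπ (C := C) r a b) Z
    have h₃ : Epi (quotπ (C := C) r a b ⊗ₘ quotπ (C := C) r b c) := by
      rw [MonoidalCategory.tensorHom_def']; exact epi_comp _ _
    -- The tensor product of two projections is epi because tensoring with an object preserves
    -- epimorphisms in closed symmetric `V`; thus compatibility with composition can be tested in
    -- `C`.
    refine (cancel_epi (quotπ (C := C) r a b ⊗ₘ quotπ (C := C) r b c)).1 ?_
    have e := quotπ_quotComp (C := C) r a b c
    refine (Category.assoc _ _ _).symm.trans ((congrArg (· ≫ _) e).trans ?_)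
    refine (Category.assoc _ _ _).trans ((congrArg (_ ≫ ·) (coequalizer.π_desc _ _)).trans ?_)
    refine (F.map_comp a b c).trans ?_
    refine Eq.trans ?_ (Category.assoc _ _ _)
    refine congrArg (· ≫ _) (Eq.trans ?_ (MonoidalCategory.tensorHom_comp_tensorHom _ _ _ _).symm)
    exact congrArg₂ (· ⊗ₘ ·) (coequalizer.π_desc _ _).symm (coequalizer.π_desc _ _).symm

lemma quotπ_quotLift (F : VFun V C E)
    (h : ∀ i, (r i).lhs ≫ F.map (r i).src (r i).tgt = (r i).rhs ≫ F.map (r i).src (r i).tgt)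
    (a b : C) : quotπ r a b ≫ (quotLift r F h).map a b = F.map a b :=
  coequalizer.π_desc _ _

/-- `V`-naturality of a family of components on a quotient can be checked before passing to the
quotient. -/
lemma quot_natural {F G : VFun V (QuotVCat r) E}
    {app : ∀ a : QuotVCat r, UHom V (F.obj a) (G.obj a)}
    (h : ∀ a b : C, quotπ r a b ≫ F.map a b ≫ postcomp (F.obj a) (app b) =
      quotπ r a b ≫ G.map a b ≫ precomp (app a) (G.obj b)) (a b : QuotVCat r) :
    F.map a b ≫ postcomp (F.obj a) (app b) = G.map a b ≫ precomp (app a) (G.obj b) :=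
  (cancel_epi (quotπ (C := C) r a b)).1 (h a b)

end QuotientUniversal

-- Compatibility with associators implies compatibility with unitors.

section Unitor

variable {V : Type v} [Category.{u} V] [MonoidalCategory V] [SymmetricCategory V]
variable {A B C D E C' D' M N : Type u} [EnrichedCategory V A] [EnrichedCategory V B]
  [EnrichedCategory V C] [EnrichedCategory V D] [EnrichedCategory V E] [EnrichedCategory V C']
  [EnrichedCategory V D'] [EnrichedCategory V M] [EnrichedCategory V N]

namespace VFun

lemma prod_mapHom (F : VFun V C C') (G : VFun V D D') {X X' : C} {Y Y' : D} (f : UHom V X X')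
    (g : UHom V Y Y') : (F.prod G).mapHom (pairHom f g) = pairHom (F.mapHom f) (G.mapHom g) := by
  show ((λ_ (𝟙_ V)).inv ≫ (uTo f ⊗ₘ uTo g)) ≫ (F.map X X' ⊗ₘ G.map Y Y') =
    (λ_ (𝟙_ V)).inv ≫ ((uTo f ≫ F.map X X') ⊗ₘ (uTo g ≫ G.map Y Y'))
  rw [Category.assoc, MonoidalCategory.tensorHom_comp_tensorHom]

lemma assocInv_mapHom {X X' : C} {Y Y' : D} {Z Z' : E} (f : UHom V X X') (g : UHom V Y Y')
    (h : UHom V Z Z') :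
    (VFun.assocInv V C D E).mapHom (pairHom f (pairHom g h)) = pairHom (pairHom f g) h :=
  tensor_unit_assoc_aux _ _ _

lemma insR_mapHom (d : D) {X X' : C} (f : UHom V X X') :
    (VFun.insR C d).mapHom f = pairHom f (uId d) := by
  show uTo f ≫ (ρ_ _).inv ≫ _ ◁ eId V d = (λ_ (𝟙_ V)).inv ≫ (uTo f ⊗ₘ uTo (uId d))
  rw [uTo_id, rightUnitor_inv_naturality_assoc, MonoidalCategory.tensorHom_def, unitors_inv_equal]

/-- The action of a `V`-functor of two variables on pairs of morphisms. -/
def map₂ (F : VFun V (C × D) E) {X X' : C} {Y Y' : D} (f : UHom V X X') (g : UHom V Y Y') :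
    UHom V (F.obj (X, Y)) (F.obj (X', Y')) := F.mapHom (pairHom f g)

lemma map₂_id (F : VFun V (C × D) E) (X : C) (Y : D) :
    F.map₂ (uId (V := V) X) (uId (V := V) Y) = uId (F.obj (X, Y)) := by
  unfold map₂
  rw [pairHom_id, mapHom_id]

lemma map₂_comp (F : VFun V (C × D) E) {X X' X'' : C} {Y Y' Y'' : D} (f : UHom V X X')
    (f' : UHom V X' X'') (g : UHom V Y Y') (g' : UHom V Y' Y'') :
    F.map₂ f g ≫ F.map₂ f' g' = F.map₂ (X := X) (X' := X'') (Y := Y) (Y' := Y'')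
      (f ≫ f') (g ≫ g') := by
  unfold map₂
  rw [pairHom_comp, mapHom_comp]

lemma map₂_comp_id (F : VFun V (C × D) E) {X X' X'' : C} {Y : D} (f : UHom V X X')
    (f' : UHom V X' X'') :
    F.map₂ f (uId Y) ≫ F.map₂ f' (uId Y) = F.map₂ (X := X) (X' := X'') (f ≫ f') (uId Y) :=
  (F.map₂_comp f f' (uId Y) (uId Y)).trans (congrArg (F.map₂ _) (Category.comp_id _))

lemma map₂_id_comp (F : VFun V (C × D) E) {X : C} {Y Y' Y'' : D} (g : UHom V Y Y')
    (g' : UHom V Y' Y'') :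
    F.map₂ (uId X) g ≫ F.map₂ (uId X) g' = F.map₂ (uId X) (Y := Y) (Y' := Y'') (g ≫ g') :=
  (F.map₂_comp (uId X) (uId X) g g').trans (congrArg (F.map₂ · _) (Category.comp_id _))

lemma map₂_left_right (F : VFun V (C × D) E) {X X' : C} {Y Y' : D} (f : UHom V X X')
    (g : UHom V Y Y') : F.map₂ f (uId Y) ≫ F.map₂ (uId X') g = F.map₂ f g :=
  (F.map₂_comp f (uId X') (uId Y) g).trans
    (congrArg₂ F.map₂ (Category.comp_id f) (Category.id_comp g))

lemma map₂_right_left (F : VFun V (C × D) E) {X X' : C} {Y Y' : D} (f : UHom V X X')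
    (g : UHom V Y Y') : F.map₂ (uId X) g ≫ F.map₂ f (uId Y') = F.map₂ f g :=
  (F.map₂_comp (uId X) f g (uId Y')).trans
    (congrArg₂ F.map₂ (Category.id_comp f) (Category.comp_id g))

instance (F : VFun V C D) {X Y : C} (f : UHom V X Y) [IsIso f] : IsIso (F.mapHom f) :=
  ⟨F.mapHom (inv f), (F.mapHom_comp f (inv f)).symm.trans
      ((congrArg F.mapHom (IsIso.hom_inv_id f)).trans (F.mapHom_id X)),
    (F.mapHom_comp (inv f) f).symm.trans
      ((congrArg F.mapHom (IsIso.inv_hom_id f)).trans (F.mapHom_id Y))⟩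

instance (F : VFun V (C × D) E) {X X' : C} {Y Y' : D} (f : UHom V X X') (g : UHom V Y Y')
    [IsIso f] [IsIso g] : IsIso (F.map₂ f g) :=
  ⟨F.map₂ (inv f) (inv g), (F.map₂_comp _ _ _ _).trans
      ((congrArg₂ F.map₂ (IsIso.hom_inv_id f) (IsIso.hom_inv_id g)).trans (F.map₂_id X Y)),
    (F.map₂_comp _ _ _ _).trans
      ((congrArg₂ F.map₂ (IsIso.inv_hom_id f) (IsIso.inv_hom_id g)).trans (F.map₂_id X' Y'))⟩

end VFun

variable {𝒜 : MonoidalVCat V A}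

namespace RightModule

variable (R : RightModule 𝒜 M)

/-- The component `(m ◁ a) ◁ b ⟶ m ◁ (a ⊗ b)` of the associativity isomorphism. -/
def assocHom (m : M) (a b : A) :
    UHom V (R.act.obj (R.act.obj (m, a), b)) (R.act.obj (m, 𝒜.tensor.obj (a, b))) :=
  natApp R.assoc.hom (m, a, b)

/-- The component `m ◁ 1 ⟶ m` of the unit isomorphism. -/
def unitHom (m : M) : UHom V (R.act.obj (m, 𝒜.unit)) m := natApp R.unitor.hom m

instance (m : M) (a b : A) : IsIso (R.assocHom m a b) :=
  inferInstanceAs (IsIso (natApp R.assoc.hom (m, a, b)))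

instance (m : M) : IsIso (R.unitHom m) := inferInstanceAs (IsIso (natApp R.unitor.hom m))

lemma assocHom_natural {m m' : M} {a a' b b' : A} (f : UHom V m m') (g : UHom V a a')
    (h : UHom V b b') :
    R.act.map₂ (R.act.map₂ f g) h ≫ R.assocHom m' a' b' =
      R.assocHom m a b ≫ R.act.map₂ f (𝒜.tensor.map₂ g h) := by
  have k := R.assoc.hom.naturality_hom (pairHom f (pairHom g h))
  rw [VFun.comp_mapHom, VFun.comp_mapHom, VFun.comp_mapHom, VFun.assocInv_mapHom,
    VFun.prod_mapHom, VFun.prod_mapHom, VFun.id_mapHom, VFun.id_mapHom] at k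
  exact k

lemma unitHom_natural {m m' : M} (f : UHom V m m') :
    R.act.map₂ f (uId 𝒜.unit) ≫ R.unitHom m' = R.unitHom m ≫ f := by
  have k := R.unitor.hom.naturality_hom f
  rw [VFun.comp_mapHom, VFun.insR_mapHom, VFun.id_mapHom] at k
  exact k

/-- By the unit isomorphism, the functor `- ◁ 1` is isomorphic to the identity, hence faithful. -/
lemma map₂_unit_injective {m m' : M} {f g : UHom V m m'}
    (h : R.act.map₂ f (uId 𝒜.unit) = R.act.map₂ g (uId 𝒜.unit)) : f = g := by
  rw [← cancel_epi (R.unitHom m), ← unitHom_natural, ← unitHom_natural, h]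

/-- Naturality of the unit isomorphism at its own component `m ◁ 1 ⟶ m`, after which that component
cancels. -/
lemma unitHom_act (m : M) :
    R.unitHom (R.act.obj (m, 𝒜.unit)) = R.act.map₂ (R.unitHom m) (uId 𝒜.unit) := by
  rw [← cancel_mono (R.unitHom m), unitHom_natural]

/-- The unit isomorphism at `m ◁ a` is the right unitor of `a`, up to associativity. -/
lemma assocHom_rightUnitor (m : M) (a : A) :
    R.assocHom m a 𝒜.unit ≫ R.act.map₂ (uId m) (natApp 𝒜.rightUnitor.hom a) =
      R.unitHom (R.act.obj (m, a)) := by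
  -- Kelly's argument: the pentagon for `(m, a, 1, 1)` is combined with the triangle at `m ◁ a` and
  -- with the image under `m ◁ -` of the triangle of `𝒜` at `(a, 1)`.
  have pent : R.act.map₂ (R.assocHom m a 𝒜.unit) (uId 𝒜.unit) ≫
        R.assocHom m (𝒜.tensor.obj (a, 𝒜.unit)) 𝒜.unit ≫
          R.act.map₂ (uId m) (natApp 𝒜.assoc.hom (a, 𝒜.unit, 𝒜.unit)) =
      R.assocHom (R.act.obj (m, a)) 𝒜.unit 𝒜.unit ≫
        R.assocHom m a (𝒜.tensor.obj (𝒜.unit, 𝒜.unit)) := R.pentagon m a 𝒜.unit 𝒜.unit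
  have tri : R.assocHom (R.act.obj (m, a)) 𝒜.unit 𝒜.unit ≫
        R.act.map₂ (uId (R.act.obj (m, a))) (natApp 𝒜.leftUnitor.hom 𝒜.unit) =
      R.act.map₂ (R.unitHom (R.act.obj (m, a))) (uId 𝒜.unit) := R.triangle _ _
  have triA : R.act.map₂ (uId m) (natApp 𝒜.assoc.hom (a, 𝒜.unit, 𝒜.unit)) ≫
        R.act.map₂ (uId m) (𝒜.tensor.map₂ (uId a) (natApp 𝒜.leftUnitor.hom 𝒜.unit)) =
      R.act.map₂ (uId m) (𝒜.tensor.map₂ (natApp 𝒜.rightUnitor.hom a) (uId 𝒜.unit)) :=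
    (R.act.map₂_id_comp _ _).trans (congrArg (R.act.map₂ (uId m)) (𝒜.triangle a 𝒜.unit))
  have n₁ := R.assocHom_natural (uId m) (natApp 𝒜.rightUnitor.hom a) (uId 𝒜.unit)
  have n₂ := R.assocHom_natural (uId m) (uId a) (natApp 𝒜.leftUnitor.hom 𝒜.unit)
  rw [VFun.map₂_id] at n₂
  -- It suffices to compare both sides after `- ◁ 1` and a further composition with the invertible
  -- `β_{m,a,1}`.
  apply R.map₂_unit_injective
  rw [← cancel_mono (R.assocHom m a 𝒜.unit)]
  have h₁ := R.act.map₂_comp_id (Y := 𝒜.unit) (R.assocHom m a 𝒜.unit)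
    (R.act.map₂ (uId m) (natApp 𝒜.rightUnitor.hom a))
  refine (congrArg (· ≫ _) h₁.symm).trans ((Category.assoc _ _ _).trans ?_)
  refine (congrArg (_ ≫ ·) (n₁.trans (congrArg (_ ≫ ·) triA.symm))).trans ?_
  have p' := congrArg (· ≫ R.act.map₂ (uId m)
    (𝒜.tensor.map₂ (uId a) (natApp 𝒜.leftUnitor.hom 𝒜.unit))) pent
  simp only [Category.assoc] at p'
  refine p'.trans ((congrArg (_ ≫ ·) n₂.symm).trans ?_)
  exact (Category.assoc _ _ _).symm.trans (congrArg (· ≫ _) tri)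

end RightModule

/-- If a `V`-natural isomorphism `S(m ◁ a, n) ≅ S(m, a ▷ n)` is compatible with associators, then
it is compatible with unitors. -/
theorem balanced_unitor (R : RightModule 𝒜 M) (L : LeftModule 𝒜 N) (S : VFun V (M × N) E)
    (θ : (actRight R N).comp S ≅ (actLeft L M).comp S)
    (hθ : ∀ (m : M) (a b : A) (n : N),
      natApp θ.hom (R.act.obj (m, a), b, n) ≫ natApp θ.hom (m, a, L.act.obj (b, n)) ≫
          S.mapHom (pairHom (uId m) (natApp L.assoc.hom (a, b, n))) =
        S.mapHom (pairHom (natApp R.assoc.hom (m, a, b)) (uId n)) ≫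
          natApp θ.hom (m, 𝒜.tensor.obj (a, b), n)) (m : M) (n : N) :
    natApp θ.hom (m, 𝒜.unit, n) ≫ S.mapHom (pairHom (uId m) (natApp L.unitor.hom n)) =
      S.mapHom (pairHom (natApp R.unitor.hom m) (uId n)) := by
  let t (m : M) (a : A) (n : N) : UHom V (S.obj (R.act.obj (m, a), n))
    (S.obj (m, L.act.obj (a, n))) := natApp θ.hom (m, a, n)
  have ht (m : M) (a : A) (n : N) : IsIso (t m a n) :=
    inferInstanceAs (IsIso (natApp θ.hom (m, a, n)))
  have nat {m m' : M} {a a' : A} {n n' : N} (f : UHom V m m') (g : UHom V a a')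
      (h : UHom V n n') : S.map₂ (R.act.map₂ f g) h ≫ t m' a' n' =
        t m a n ≫ S.map₂ f (L.act.map₂ g h) := by
    have k := θ.hom.naturality_hom (pairHom f (pairHom g h))
    rw [VFun.comp_mapHom, VFun.comp_mapHom, VFun.comp_mapHom, VFun.assocInv_mapHom,
      VFun.prod_mapHom, VFun.prod_mapHom, VFun.id_mapHom, VFun.id_mapHom] at k
    exact k
  let η (n : N) : UHom V (L.act.obj (𝒜.unit, n)) n := natApp L.unitor.hom n
  -- The unitor condition at objects of the form `m ◁ a`, where the associator condition with second
  -- entry `1` applies.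
  have step (m : M) (a : A) (n : N) : t (R.act.obj (m, a)) 𝒜.unit n ≫
      S.map₂ (uId (R.act.obj (m, a))) (η n) =
        S.map₂ (R.unitHom (R.act.obj (m, a))) (uId n) := by
    have h₁ : t (R.act.obj (m, a)) 𝒜.unit n ≫ t m a (L.act.obj (𝒜.unit, n)) ≫
        S.map₂ (uId m) (natApp L.assoc.hom (a, 𝒜.unit, n)) =
          S.map₂ (R.assocHom m a 𝒜.unit) (uId n) ≫ t m (𝒜.tensor.obj (a, 𝒜.unit)) n :=
      hθ m a 𝒜.unit n
    have h₂ : S.map₂ (uId m) (natApp L.assoc.hom (a, 𝒜.unit, n)) ≫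
        S.map₂ (uId m) (L.act.map₂ (natApp 𝒜.rightUnitor.hom a) (uId n)) =
          S.map₂ (uId m) (L.act.map₂ (uId a) (η n)) :=
      (S.map₂_id_comp _ _).trans (congrArg (S.map₂ (uId m)) (L.triangle a n))
    have h₃ := nat (uId m) (uId a) (η n)
    rw [VFun.map₂_id] at h₃
    have h₄ := nat (uId m) (natApp 𝒜.rightUnitor.hom a) (uId n)
    have h₅ : S.map₂ (R.assocHom m a 𝒜.unit) (uId n) ≫
        S.map₂ (R.act.map₂ (uId m) (natApp 𝒜.rightUnitor.hom a)) (uId n) =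
          S.map₂ (R.unitHom (R.act.obj (m, a))) (uId n) :=
      (S.map₂_comp_id _ _).trans (congrArg (S.map₂ · (uId n)) (R.assocHom_rightUnitor m a))
    -- After composing with `t m a n`, naturality in `n` moves `η` past it, the left triangle
    -- replaces `a ▷ η_n` by `β` and `ρ_a ▷ n`, and the associator condition with naturality in `a`
    -- moves everything to the left factor. There `assocHom_rightUnitor` identifies the result.
    rw [← cancel_mono (t m a n), ← h₅, Category.assoc, Category.assoc]
    refine (congrArg (_ ≫ ·) (h₃.trans (congrArg (_ ≫ ·) h₂.symm))).trans ?_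
    have h₆ := congrArg (· ≫ S.map₂ (uId m)
      (L.act.map₂ (natApp 𝒜.rightUnitor.hom a) (uId n))) h₁
    simp only [Category.assoc] at h₆
    exact h₆.trans (congrArg (_ ≫ ·) h₄.symm)
  show t m 𝒜.unit n ≫ S.map₂ (uId m) (η n) = S.map₂ (R.unitHom m) (uId n)
  -- Naturality of `t` along `m ◁ 1 ⟶ m` reduces `m` to `m ◁ 1`, the case `a = 1` of `step`; the two
  -- resulting morphisms agree by `unitHom_act`.
  have h₁ := nat (R.unitHom m) (uId 𝒜.unit) (uId n)
  rw [VFun.map₂_id] at h₁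
  rw [← cancel_epi (S.map₂ (R.act.map₂ (R.unitHom m) (uId 𝒜.unit)) (uId n)), ← Category.assoc]
  refine (congrArg (· ≫ _) h₁).trans ((Category.assoc _ _ _).trans ?_)
  refine (congrArg (_ ≫ ·) ((S.map₂_left_right _ _).trans (S.map₂_right_left _ _).symm)).trans ?_
  refine (Category.assoc _ _ _).symm.trans ((congrArg (· ≫ _) (step m 𝒜.unit n)).trans ?_)
  rw [R.unitHom_act]

end Unitor

-- Cocones as functors `S` with an isomorphism `S F₀ ≅ S F₁`.

section BalancedCocones

variable {V : Type v} [Category.{u} V] [MonoidalCategory V]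
variable {A B C D E : Type u} [EnrichedCategory V A] [EnrichedCategory V B]
  [EnrichedCategory V C] [EnrichedCategory V D] [EnrichedCategory V E]

/-- The associativity isomorphism for the composition of `V`-functors. -/
def VFun.compAssoc (F : VFun V B C) (G : VFun V C D) (H : VFun V D E) :
    F.comp (G.comp H) ≅ (F.comp G).comp H where
  hom := VNatTrans.mk (fun _ => uId _) (fun _ _ => comp_uId_comm (Category.assoc _ _ _).symm)
  inv := VNatTrans.mk (fun _ => uId _) (fun _ _ => comp_uId_comm (Category.assoc _ _ _))
  hom_inv_id := nat_ext fun _ => Category.comp_id _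
  inv_hom_id := nat_ext fun _ => Category.comp_id _

namespace BarCocone

variable {X : BarShape V A B C}

/-- The compatibility of `σ_C ∘ F₀ ≅ σ_C ∘ F₁` with the `2`-morphisms of the diagram. -/
lemma theta_rel (σ : BarCocone X E) (a : A) :
    (natApp σ.theta.hom (X.G₀.obj a) ≫ σ.sC.mapHom (natApp X.κ₁ a)) ≫
        natApp σ.theta.hom (X.G₂.obj a) ≫ σ.sC.mapHom (natApp X.κ₃ a) =
      σ.sC.mapHom (natApp X.κ₂ a) ≫ natApp σ.theta.hom (X.G₁.obj a) := by
  have aux {𝒞 : Type u} [Category.{u} 𝒞] {a b₀ b₁ b₂ c₀₀ c₁₀ c₀₂ c₁₂ c₀₁ c₁₁ : 𝒞}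
      {g₀ : a ⟶ b₀} {g₁ : a ⟶ b₁} {g₂ : a ⟶ b₂} {f₀₀ : b₀ ⟶ c₀₀} {f₁₀ : b₀ ⟶ c₁₀}
      {f₀₂ : b₂ ⟶ c₀₂} {f₁₂ : b₂ ⟶ c₁₂} {f₀₁ : b₁ ⟶ c₀₁} {f₁₁ : b₁ ⟶ c₁₁} {k₁ : c₁₀ ⟶ c₀₂}
      {k₂ : c₀₀ ⟶ c₀₁} {k₃ : c₁₂ ⟶ c₁₁} {t₀ : c₀₀ ⟶ c₁₀} {t₁ : c₀₁ ⟶ c₁₁} {t₂ : c₀₂ ⟶ c₁₂}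
      [Epi (g₀ ≫ f₀₀)] (r₁ : (g₀ ≫ f₁₀) ≫ k₁ = g₂ ≫ f₀₂) (r₂ : (g₀ ≫ f₀₀) ≫ k₂ = g₁ ≫ f₀₁)
      (r₃ : (g₂ ≫ f₁₂) ≫ k₃ = g₁ ≫ f₁₁) (h₀ : f₀₀ ≫ t₀ = f₁₀) (h₁ : f₀₁ ≫ t₁ = f₁₁)
      (h₂ : f₀₂ ≫ t₂ = f₁₂) : (t₀ ≫ k₁) ≫ t₂ ≫ k₃ = k₂ ≫ t₁ := by
    -- Starting from the invertible `Δ₀₀`, one side runs through `Δ₁₀`, `Δ₀₂`, `Δ₁₂` to `Δ₁₁` and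
    -- the other through `Δ₀₁` to `Δ₁₁`.
    rw [← cancel_epi (g₀ ≫ f₀₀), ← Category.assoc _ k₂, r₂]
    simp only [Category.assoc] at r₁ r₃ ⊢
    rw [h₁, reassoc_of% h₀, reassoc_of% r₁, reassoc_of% h₂, r₃]
  have : Epi (natApp σ.sG₀.hom a ≫ natApp σ.sF₀.hom (X.G₀.obj a)) := epi_comp _ _
  exact aux (σ.rel₁ a) (σ.rel₂ a) (σ.rel₃ a) (σ.sF₀_theta _) (σ.sF₀_theta _) (σ.sF₀_theta _)

/-- The cocone given by a `V`-functor `S : C ⟶ E` and an isomorphism `S ∘ F₀ ≅ S ∘ F₁` compatible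
with the `2`-morphisms of the diagram, if the first two of these are invertible. -/
noncomputable def ofBalanced (h₁ : ∀ a, IsIso (natApp X.κ₁ a)) (h₂ : ∀ a, IsIso (natApp X.κ₂ a))
    (S : VFun V C E) (θ : X.F₀.comp S ≅ X.F₁.comp S)
    (hθ : ∀ a, (natApp θ.hom (X.G₀.obj a) ≫ S.mapHom (natApp X.κ₁ a)) ≫
        natApp θ.hom (X.G₂.obj a) ≫ S.mapHom (natApp X.κ₃ a) =
      S.mapHom (natApp X.κ₂ a) ≫ natApp θ.hom (X.G₁.obj a)) : BarCocone X E :=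
  let α₁ := natIsoOfIsIso (VFun.whiskerR X.κ₁ S)
    (fun a => inferInstanceAs (IsIso (S.mapHom (natApp X.κ₁ a))))
  let α₂ := natIsoOfIsIso (VFun.whiskerR X.κ₂ S)
    (fun a => inferInstanceAs (IsIso (S.mapHom (natApp X.κ₂ a))))
  let β : X.G₀.comp (X.F₀.comp S) ≅ X.G₀.comp (X.F₁.comp S) :=
    natIsoOfIsIso (VFun.whiskerL X.G₀ θ.hom)
      (fun a => inferInstanceAs (IsIso (natApp θ.hom (X.G₀.obj a))))
  -- With `σ_{G₀}` and `σ_{F₀}` taken to be identities, the conditions on `κ₂` and `κ₁` force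
  -- `σ_{G₁}` and `σ_{G₂}` to have components `S κ₂` and `θ` followed by `S κ₁`. The condition on
  -- `κ₃` is then the hypothesis on `θ`.
  let γ₁ : X.G₀.comp (X.F₀.comp S) ≅ X.G₁.comp (X.F₀.comp S) :=
    VFun.compAssoc _ _ _ ≪≫ α₂ ≪≫ (VFun.compAssoc _ _ _).symm
  let γ₂ : X.G₀.comp (X.F₀.comp S) ≅ X.G₂.comp (X.F₀.comp S) :=
    β ≪≫ VFun.compAssoc _ _ _ ≪≫ α₁ ≪≫ (VFun.compAssoc _ _ _).symm
  have e₁ (a : A) : natApp γ₁.hom a = S.mapHom (natApp X.κ₂ a) :=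
    (Category.id_comp _).trans (Category.comp_id _)
  have e₂ (a : A) : natApp γ₂.hom a =
      natApp θ.hom (X.G₀.obj a) ≫ S.mapHom (natApp X.κ₁ a) :=
    congrArg (natApp θ.hom (X.G₀.obj a) ≫ ·) ((Category.id_comp _).trans (Category.comp_id _))
  { sA := X.G₀.comp (X.F₀.comp S)
    sB := X.F₀.comp S
    sC := S
    sG₀ := Iso.refl _
    sG₁ := γ₁
    sG₂ := γ₂
    sF₀ := Iso.refl _
    sF₁ := θ
    rel₁ := fun a => (congrArg (· ≫ _) (Category.id_comp _)).trans
      ((e₂ a).symm.trans (Category.comp_id _).symm)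
    rel₂ := fun a => (congrArg (· ≫ _) (Category.id_comp _)).trans
      ((Category.id_comp _).trans ((e₁ a).symm.trans (Category.comp_id _).symm))
    rel₃ := fun a => (congrArg (fun k => (k ≫ natApp θ.hom (X.G₂.obj a)) ≫ _) (e₂ a)).trans
      ((Category.assoc _ _ _).trans ((hθ a).trans (congrArg (· ≫ _) (e₁ a)).symm)) }

end BarCocone
end BalancedCocones

-- The cocone with summit the relative tensor product.

section TambaraUniversal

variable {V : Type v} [Category.{u} V] [MonoidalCategory V] [SymmetricCategory V]
  {A M N E : Type u} [EnrichedCategory V A] [EnrichedCategory V M] [EnrichedCategory V N]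
  [EnrichedCategory V E] {𝒜 : MonoidalVCat V A} (R : RightModule 𝒜 M) (L : LeftModule 𝒜 N)

instance (x : M × A × A × N) : IsIso (natApp (barDiagram R L).κ₁ x) :=
  inferInstanceAs (IsIso (uId (V := V) (R.act.obj (x.1, x.2.1), L.act.obj (x.2.2.1, x.2.2.2))))

instance isIso_pairHom {C D : Type u} [EnrichedCategory V C] [EnrichedCategory V D] {X X' : C}
    {Y Y' : D} (f : UHom V X X') (g : UHom V Y Y') [IsIso f] [IsIso g] : IsIso (pairHom f g) :=
  ⟨pairHom (inv f) (inv g), (pairHom_comp _ _ _ _).symm.trans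
      ((congrArg₂ pairHom (IsIso.hom_inv_id f) (IsIso.hom_inv_id g)).trans (pairHom_id X Y)),
    (pairHom_comp _ _ _ _).symm.trans
      ((congrArg₂ pairHom (IsIso.inv_hom_id f) (IsIso.inv_hom_id g)).trans (pairHom_id X' Y'))⟩

instance (x : M × A × A × N) : IsIso (natApp (barDiagram R L).κ₂ x) :=
  inferInstanceAs (IsIso (pairHom (natApp R.assoc.hom (x.1, x.2.1, x.2.2.1)) (uId x.2.2.2)))

/-- For the bar construction, compatibility of `θ` with the `2`-morphisms is its compatibility with
the associators. -/
lemma bar_balanced_iff (S : VFun V (M × N) E)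
    (θ : (barDiagram R L).F₀.comp S ≅ (barDiagram R L).F₁.comp S) (m : M) (a b : A) (n : N) :
    ((natApp θ.hom ((barDiagram R L).G₀.obj (m, a, b, n)) ≫
        S.mapHom (natApp (barDiagram R L).κ₁ (m, a, b, n))) ≫
          natApp θ.hom ((barDiagram R L).G₂.obj (m, a, b, n)) ≫
            S.mapHom (natApp (barDiagram R L).κ₃ (m, a, b, n)) =
      S.mapHom (natApp (barDiagram R L).κ₂ (m, a, b, n)) ≫
        natApp θ.hom ((barDiagram R L).G₁.obj (m, a, b, n))) ↔
    natApp θ.hom (R.act.obj (m, a), b, n) ≫ natApp θ.hom (m, a, L.act.obj (b, n)) ≫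
          S.mapHom (pairHom (uId m) (natApp L.assoc.hom (a, b, n))) =
        S.mapHom (pairHom (natApp R.assoc.hom (m, a, b)) (uId n)) ≫
          natApp θ.hom (m, 𝒜.tensor.obj (a, b), n) := by
  -- The `2`-morphism `κ₁` is an identity and drops out; the remaining data unfold to the associator
  -- condition.
  have e : natApp θ.hom ((barDiagram R L).G₀.obj (m, a, b, n)) ≫
      S.mapHom (natApp (barDiagram R L).κ₁ (m, a, b, n)) =
        natApp θ.hom ((barDiagram R L).G₀.obj (m, a, b, n)) :=
    (congrArg (_ ≫ ·) (S.mapHom_id _)).trans (Category.comp_id _)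
  rw [e]
  exact Iff.rfl

variable [MonoidalClosed V] [HasColimits V]

namespace Tambara

/-- The projection from the free `V`-category. -/
noncomputable abbrev proj : VFun V (TambaraFree R L) (Tambara R L) := quotProj (tambaraRel R L)

/-- The canonical `V`-functor `M × N ⟶ M ×_A N`. -/
noncomputable def incl : VFun V (M × N) (Tambara R L) where
  obj x := x
  map x y := TambaraFree.incl R L x y ≫ (proj R L).map x y
  map_id x := by
    have h : (uTo (uId (V := V) x) ≫ TambaraFree.incl R L x x) ≫ (proj R L).map x x =
        uTo (uId (V := V) (FreeVCat.of (tambaraGraph R L) x)) ≫ (proj R L).map x x :=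
      rel_quotπ (tambaraRel R L) (.id x)
    rw [uTo_id] at h
    refine (Category.assoc _ _ _).symm.trans (h.trans ?_)
    exact (congrArg (· ≫ _) (uTo_id (V := V) (FreeVCat.of (tambaraGraph R L) x))).trans
      ((proj R L).map_id (FreeVCat.of (tambaraGraph R L) x))
  map_comp x y z := by
    have h := rel_quotπ (tambaraRel R L) (.comp x y z)
    have k := (proj R L).map_comp x y z
    refine (Category.assoc _ _ _).symm.trans (h.trans ((Category.assoc _ _ _).trans ?_))
    refine (congrArg (_ ≫ ·) k).trans ((Category.assoc _ _ _).symm.trans ?_)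
    exact congrArg (· ≫ _) (MonoidalCategory.tensorHom_comp_tensorHom _ _ _ _)

lemma incl_mapHom {x y : M × N} (f : UHom V x y) :
    (incl R L).mapHom f = (proj R L).mapHom (TambaraFree.inclHom R L f) :=
  (Category.assoc _ _ _).symm

/-- The morphism `(m ◁ a, n) ⟶ (m, a ▷ n)` of the relative tensor product. -/
noncomputable def iota (m : M) (a : A) (n : N) :
    UHom V ((incl R L).obj (R.act.obj (m, a), n)) ((incl R L).obj (m, L.act.obj (a, n))) :=
  (proj R L).mapHom (TambaraFree.iota R L m a n)

/-- The morphism `(m, a ▷ n) ⟶ (m ◁ a, n)` of the relative tensor product. -/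
noncomputable def iotaInv (m : M) (a : A) (n : N) :
    UHom V ((incl R L).obj (m, L.act.obj (a, n))) ((incl R L).obj (R.act.obj (m, a), n)) :=
  (proj R L).mapHom (TambaraFree.iotaInv R L m a n)

lemma iota_iotaInv (m : M) (a : A) (n : N) :
    iota R L m a n ≫ iotaInv R L m a n = uId ((incl R L).obj (R.act.obj (m, a), n)) :=
  ((proj R L).mapHom_comp _ _).symm.trans
    ((rel_quotπ (tambaraRel R L) (.isoLeft m a n)).trans ((proj R L).mapHom_id _))

lemma iotaInv_iota (m : M) (a : A) (n : N) :
    iotaInv R L m a n ≫ iota R L m a n = uId ((incl R L).obj (m, L.act.obj (a, n))) :=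
  ((proj R L).mapHom_comp _ _).symm.trans
    ((rel_quotπ (tambaraRel R L) (.isoRight m a n)).trans ((proj R L).mapHom_id _))

instance (m : M) (a : A) (n : N) : IsIso (iota R L m a n) :=
  ⟨iotaInv R L m a n, iota_iotaInv R L m a n, iotaInv_iota R L m a n⟩

/-- The morphisms `ι` form a `V`-natural transformation. -/
noncomputable def iotaNat :
    (actRight R N).comp (incl R L) ⟶ (actLeft L M).comp (incl R L) :=
  VNatTrans.mk (fun x => iota R L x.1 x.2.1 x.2.2) (fun x y => by
    have h := rel_quotπ (tambaraRel R L) (.naturality x y)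
    -- The naturality relation speaks of composition with the free generators; `k₁` and `k₂` carry
    -- this through the projection to composition with `ι` in the quotient.
    have k₁ := (proj R L).map_postcomp
      (FreeVCat.of (tambaraGraph R L) (R.act.obj (x.1, x.2.1), x.2.2))
      (TambaraFree.iota R L y.1 y.2.1 y.2.2)
    have k₂ := (proj R L).map_precomp (TambaraFree.iota R L x.1 x.2.1 x.2.2)
      (FreeVCat.of (tambaraGraph R L) (y.1, L.act.obj (y.2.1, y.2.2)))
    refine (Category.assoc _ _ _).trans ?_
    refine (congrArg (_ ≫ ·) (Category.assoc _ _ _)).trans ?_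
    refine (congrArg (fun k => (actRight R N).map x y ≫ TambaraFree.incl R L _ _ ≫ k) k₁).trans ?_
    refine Eq.trans ?_ (Category.assoc _ _ _).symm
    refine Eq.trans ?_ (congrArg (_ ≫ ·) (Category.assoc _ _ _)).symm
    refine Eq.trans ?_
      (congrArg (fun k => (actLeft L M).map x y ≫ TambaraFree.incl R L _ _ ≫ k) k₂).symm
    have e {P Q S T U : V} (a : P ⟶ Q) (b : Q ⟶ S) (c : S ⟶ T) (d : T ⟶ U) :
      a ≫ b ≫ c ≫ d = (a ≫ b ≫ c) ≫ d := by simp only [Category.assoc]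
    exact (e _ _ _ _).trans (h.trans (e _ _ _ _).symm))

/-- The isomorphism `(m ◁ a, n) ≅ (m, a ▷ n)` of the relative tensor product. -/
noncomputable def iotaIso :
    (actRight R N).comp (incl R L) ≅ (actLeft L M).comp (incl R L) :=
  natIsoOfIsIso (iotaNat R L) fun x => inferInstanceAs (IsIso (iota R L x.1 x.2.1 x.2.2))

lemma iota_associator (m : M) (a b : A) (n : N) :
    iota R L (R.act.obj (m, a)) b n ≫ iota R L m a (L.act.obj (b, n)) ≫
        (incl R L).mapHom (pairHom (uId m) (natApp L.assoc.hom (a, b, n))) =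
      (incl R L).mapHom (pairHom (natApp R.assoc.hom (m, a, b)) (uId n)) ≫
        iota R L m (𝒜.tensor.obj (a, b)) n := by
  have h : (proj R L).mapHom _ = (proj R L).mapHom _ :=
    rel_quotπ (tambaraRel R L) (.associator m a b n)
  rw [incl_mapHom, incl_mapHom]
  refine Eq.trans ?_ (h.trans ((proj R L).mapHom_comp _ _))
  refine Eq.symm (((proj R L).mapHom_comp _ _).trans ?_)
  exact congrArg (_ ≫ ·) ((proj R L).mapHom_comp _ _)

/-- The cocone with summit the relative tensor product. -/
noncomputable def cocone : BarCocone (barDiagram R L) (Tambara R L) :=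
  BarCocone.ofBalanced (X := barDiagram R L) inferInstance inferInstance (incl R L) (iotaIso R L)
    fun ⟨m, a, b, n⟩ => (bar_balanced_iff R L (incl R L) (iotaIso R L) m a b n).2
      (iota_associator R L m a b n)

end Tambara
end TambaraUniversal

-- The universal property of the relative tensor product.

section TambaraLift

variable {V : Type v} [Category.{u} V] [MonoidalCategory V] [SymmetricCategory V]
  {A M N E : Type u} [EnrichedCategory V A] [EnrichedCategory V M] [EnrichedCategory V N]
  [EnrichedCategory V E] {𝒜 : MonoidalVCat V A} {R : RightModule 𝒜 M} {L : LeftModule 𝒜 N}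

/-- The image of a summand of `Ω(x, y)` under the `V`-functor determined by `S` and `θ`. -/
def TambaraEdge.lift (S : VFun V (M × N) E)
    (θ : (actRight R N).comp S ≅ (actLeft L M).comp S) :
    ∀ {x y : M × N} (e : TambaraEdge R L x y), e.obj ⟶ (S.obj x ⟶[V] S.obj y)
  | _, _, .hom x y => S.map x y
  | _, _, .iota m a n => uTo (natApp θ.hom (m, a, n))
  | _, _, .iotaInv m a n => uTo (natApp θ.inv (m, a, n))

variable [MonoidalClosed V] [HasColimits V]

/-- The `V`-functor from the free `V`-category determined by `S` and `θ`. -/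
noncomputable def TambaraFree.lift (S : VFun V (M × N) E)
    (θ : (actRight R N).comp S ≅ (actLeft L M).comp S) : VFun V (TambaraFree R L) E :=
  freeLift S.obj fun _ _ => Sigma.desc fun e => TambaraEdge.lift S θ e

namespace TambaraFree

variable (S : VFun V (M × N) E) (θ : (actRight R N).comp S ≅ (actLeft L M).comp S)

lemma edge_lift {x y : M × N} (e : TambaraEdge R L x y) :
    edge R L e ≫ (lift S θ).map (FreeVCat.of (tambaraGraph R L) x)
      (FreeVCat.of (tambaraGraph R L) y) = TambaraEdge.lift S θ e := by
  refine (Category.assoc _ _ _).trans ?_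
  refine (congrArg (Sigma.ι (fun e : TambaraEdge R L x y => e.obj) e ≫ ·)
    (gen_freeLift _ _ x y)).trans ?_
  exact Sigma.ι_desc (fun e : TambaraEdge R L x y => TambaraEdge.lift S θ e) e

lemma incl_lift (x y : M × N) :
    incl R L x y ≫ (lift S θ).map (FreeVCat.of (tambaraGraph R L) x)
      (FreeVCat.of (tambaraGraph R L) y) = S.map x y := edge_lift S θ (.hom x y)

lemma lift_inclHom {x y : M × N} (f : UHom V x y) :
    (lift S θ).mapHom (inclHom R L f) = S.mapHom f :=
  (Category.assoc _ _ _).trans (congrArg (uTo f ≫ ·) (incl_lift S θ x y))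

lemma lift_iota (m : M) (a : A) (n : N) :
    (lift S θ).mapHom (iota R L m a n) = natApp θ.hom (m, a, n) := edge_lift S θ (.iota m a n)

lemma lift_iotaInv (m : M) (a : A) (n : N) :
    (lift S θ).mapHom (iotaInv R L m a n) = natApp θ.inv (m, a, n) :=
  edge_lift S θ (.iotaInv m a n)

/-- The `V`-functor determined by `S` and `θ` respects the defining relations of the relative
tensor product. -/
lemma lift_rel
    (hθ : ∀ (m : M) (a b : A) (n : N),
      natApp θ.hom (R.act.obj (m, a), b, n) ≫ natApp θ.hom (m, a, L.act.obj (b, n)) ≫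
          S.mapHom (pairHom (uId m) (natApp L.assoc.hom (a, b, n))) =
        S.mapHom (pairHom (natApp R.assoc.hom (m, a, b)) (uId n)) ≫
          natApp θ.hom (m, 𝒜.tensor.obj (a, b), n))
    (i : TambaraIndex M A N) :
    (tambaraRel R L i).lhs ≫ (lift S θ).map (tambaraRel R L i).src (tambaraRel R L i).tgt =
      (tambaraRel R L i).rhs ≫ (lift S θ).map (tambaraRel R L i).src (tambaraRel R L i).tgt := by
  cases i with
  | comp x y z =>
    refine (Category.assoc _ _ _).trans ((congrArg (_ ≫ ·) (incl_lift S θ x z)).trans ?_)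
    refine (S.map_comp x y z).trans (Eq.symm ?_)
    refine (Category.assoc _ _ _).trans ((congrArg (_ ≫ ·) ((lift S θ).map_comp _ _ _)).trans ?_)
    refine (Category.assoc _ _ _).symm.trans (congrArg (· ≫ _) ?_)
    refine (MonoidalCategory.tensorHom_comp_tensorHom _ _ _ _).trans ?_
    exact congrArg₂ (· ⊗ₘ ·) (incl_lift S θ x y) (incl_lift S θ y z)
  | id x =>
    exact (lift_inclHom S θ (uId x)).trans ((S.mapHom_id x).trans ((lift S θ).mapHom_id _).symm)
  | isoLeft m a n =>
    refine ((lift S θ).mapHom_comp _ _).trans (Eq.trans ?_ ((lift S θ).mapHom_id _).symm)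
    rw [lift_iota, lift_iotaInv]
    exact (natIsoApp θ (m, a, n)).hom_inv_id
  | isoRight m a n =>
    refine ((lift S θ).mapHom_comp _ _).trans (Eq.trans ?_ ((lift S θ).mapHom_id _).symm)
    rw [lift_iota, lift_iotaInv]
    exact (natIsoApp θ (m, a, n)).inv_hom_id
  | naturality x y =>
    have k₁ := (lift S θ).map_postcomp
      (FreeVCat.of (tambaraGraph R L) (R.act.obj (x.1, x.2.1), x.2.2))
      (iota R L y.1 y.2.1 y.2.2)
    have k₂ := (lift S θ).map_precomp (iota R L x.1 x.2.1 x.2.2)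
      (FreeVCat.of (tambaraGraph R L) (y.1, L.act.obj (y.2.1, y.2.2)))
    rw [lift_iota] at k₁ k₂
    have e {P Q S T U : V} (a : P ⟶ Q) (b : Q ⟶ S) (c : S ⟶ T) (d : T ⟶ U) :
      (a ≫ b ≫ c) ≫ d = a ≫ b ≫ c ≫ d := by simp only [Category.assoc]
    have e' {P Q S T T' U : V} {a : P ⟶ Q} {b : Q ⟶ S} {c : S ⟶ T} {d : T ⟶ U} {c' : S ⟶ T'}
        {d' : T' ⟶ U} (h : c ≫ d = c' ≫ d') : (a ≫ b ≫ c) ≫ d = a ≫ (b ≫ c') ≫ d' := by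
      simp only [Category.assoc, h]
    refine (e' k₁.symm).trans (Eq.trans ?_ (e' k₂.symm).symm)
    refine (congrArg (fun k => _ ≫ k ≫ _) (incl_lift S θ _ _)).trans ?_
    refine Eq.trans ?_ (congrArg (fun k => _ ≫ k ≫ _) (incl_lift S θ _ _)).symm
    -- After `ι` is replaced by `θ`, the relation is exactly `V`-naturality of `θ`.
    have h := θ.hom.naturality x y
    exact (Category.assoc _ _ _).symm.trans (h.trans (Category.assoc _ _ _))
  | associator m a b n =>
    refine ((lift S θ).mapHom_comp _ _).trans (Eq.trans ?_ ((lift S θ).mapHom_comp _ _).symm)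
    refine (congrArg (_ ≫ ·) ((lift S θ).mapHom_comp _ _)).trans ?_
    rw [lift_iota, lift_iota, lift_iota, lift_inclHom, lift_inclHom]
    exact hθ m a b n
  | unitor m n =>
    refine ((lift S θ).mapHom_comp _ _).trans (Eq.trans ?_ (lift_inclHom S θ _).symm)
    rw [lift_iota, lift_inclHom]
    -- The one relation not directly among the data: it is derived from the associator condition.
    exact balanced_unitor R L S θ hθ m n

end TambaraFree

namespace Tambara

/-- The `V`-functor out of the relative tensor product determined by `S` and `θ`. -/
noncomputable def lift (S : VFun V (M × N) E) (θ : (actRight R N).comp S ≅ (actLeft L M).comp S)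
    (hθ : ∀ (m : M) (a b : A) (n : N),
      natApp θ.hom (R.act.obj (m, a), b, n) ≫ natApp θ.hom (m, a, L.act.obj (b, n)) ≫
          S.mapHom (pairHom (uId m) (natApp L.assoc.hom (a, b, n))) =
        S.mapHom (pairHom (natApp R.assoc.hom (m, a, b)) (uId n)) ≫
          natApp θ.hom (m, 𝒜.tensor.obj (a, b), n)) : VFun V (Tambara R L) E :=
  quotLift (tambaraRel R L) (TambaraFree.lift S θ) (TambaraFree.lift_rel S θ hθ)

section

variable (S : VFun V (M × N) E) (θ : (actRight R N).comp S ≅ (actLeft L M).comp S)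
    (hθ : ∀ (m : M) (a b : A) (n : N),
      natApp θ.hom (R.act.obj (m, a), b, n) ≫ natApp θ.hom (m, a, L.act.obj (b, n)) ≫
          S.mapHom (pairHom (uId m) (natApp L.assoc.hom (a, b, n))) =
        S.mapHom (pairHom (natApp R.assoc.hom (m, a, b)) (uId n)) ≫
          natApp θ.hom (m, 𝒜.tensor.obj (a, b), n))

lemma incl_lift (x y : M × N) :
    (incl R L).map x y ≫ (lift S θ hθ).map ((incl R L).obj x) ((incl R L).obj y) = S.map x y :=
  (Category.assoc _ _ _).trans ((congrArg (_ ≫ ·) (quotπ_quotLift (tambaraRel R L)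
    (TambaraFree.lift S θ) (TambaraFree.lift_rel S θ hθ) _ _)).trans
      (TambaraFree.incl_lift S θ x y))

lemma lift_iota (m : M) (a : A) (n : N) :
    (lift S θ hθ).mapHom (iota R L m a n) = natApp θ.hom (m, a, n) :=
  (Category.assoc _ _ _).trans ((congrArg (_ ≫ ·) (quotπ_quotLift (tambaraRel R L)
    (TambaraFree.lift S θ) (TambaraFree.lift_rel S θ hθ) _ _)).trans
      (TambaraFree.lift_iota S θ m a n))

/-- The restriction of `lift S θ` along `M × N ⟶ M ×_A N` is `S`. -/
noncomputable def inclLift : (incl R L).comp (lift S θ hθ) ≅ S where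
  hom := VNatTrans.mk (fun x => uId (S.obj x)) (fun x y => comp_uId_comm (incl_lift S θ hθ x y))
  inv := VNatTrans.mk (fun x => uId (S.obj x))
    (fun x y => comp_uId_comm (incl_lift S θ hθ x y).symm)
  hom_inv_id := nat_ext fun _ => Category.comp_id _
  inv_hom_id := nat_ext fun _ => Category.comp_id _

end

/-- The image of `ι` under a `V`-functor, as an isomorphism. -/
noncomputable def iotaMapIso (F : VFun V (Tambara R L) E) (m : M) (a : A) (n : N) :
    ForgetEnrichment.of V (F.obj ((incl R L).obj (R.act.obj (m, a), n))) ≅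
      ForgetEnrichment.of V (F.obj ((incl R L).obj (m, L.act.obj (a, n)))) where
  hom := F.mapHom (iota R L m a n)
  inv := F.mapHom (iotaInv R L m a n)
  hom_inv_id := (F.mapHom_comp _ _).symm.trans
    ((congrArg F.mapHom (iota_iotaInv R L m a n)).trans (F.mapHom_id _))
  inv_hom_id := (F.mapHom_comp _ _).symm.trans
    ((congrArg F.mapHom (iotaInv_iota R L m a n)).trans (F.mapHom_id _))

/-- `V`-naturality of a family of components on the relative tensor product can be checked on
`M × N` and on the morphisms `ι`. -/
lemma natural {F G : VFun V (Tambara R L) E}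
    {app : ∀ x : Tambara R L, UHom V (F.obj x) (G.obj x)}
    (h : ∀ x y : M × N, NaturalAt F G app ((incl R L).map x y))
    (hι : ∀ (m : M) (a : A) (n : N),
      F.mapHom (iota R L m a n) ≫ app ((incl R L).obj (m, L.act.obj (a, n))) =
        app ((incl R L).obj (R.act.obj (m, a), n)) ≫ G.mapHom (iota R L m a n))
    (x y : Tambara R L) :
    F.map x y ≫ postcomp (F.obj x) (app y) = G.map x y ≫ precomp (app x) (G.obj y) := by
  refine quot_natural (tambaraRel R L) (app := app) (fun a b => ?_) x y
  -- Naturality on each summand of `Ω`: the first two kinds are the hypotheses, and the square for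
  -- `ι⁻¹` is that for `ι` with both images of `ι` inverted.
  have key : ∀ {x y : M × N} (e : TambaraEdge R L x y),
      NaturalAt F G app (TambaraFree.edge R L e ≫ (proj R L).map _ _) := by
    intro x y e
    cases e with
    | hom x y => exact h x y
    | iota m a n => exact NaturalAt.of_hom (hι m a n)
    | iotaInv m a n =>
      exact NaturalAt.of_hom (f := iotaInv R L m a n)
        (inv_comp_comm (iotaMapIso F m a n) (iotaMapIso G m a n) (hι m a n).symm).symm
  have assoc {P Q S T U W : V} (a : P ⟶ Q) (b : Q ⟶ S) (c : S ⟶ T) (d : T ⟶ U) (e : U ⟶ W) :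
      a ≫ b ≫ (c ≫ d) ≫ e = ((a ≫ b) ≫ c) ≫ d ≫ e := by simp only [Category.assoc]
  -- The free `V`-category and its quotient have the same objects, so the same components serve for
  -- the functors precomposed with the projection.
  have e₁ := free_natural (Ω := tambaraGraph R L) (F := (proj R L).comp F)
    (G := (proj R L).comp G) (app := app) (fun x y => Sigma.hom_ext _ _ fun e =>
      (assoc _ _ _ _ _).trans ((key e).trans (assoc _ _ _ _ _).symm)) a b
  exact (Category.assoc _ _ _).symm.trans (e₁.trans (Category.assoc _ _ _))

variable (R L) in
-- In this cocone `σ_{F₀}` is an identity, so `θ` is `σ_{F₁}`, that is, `ι`.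
lemma cocone_theta (x : M × A × N) :
    natApp (cocone R L).theta.hom x = iota R L x.1 x.2.1 x.2.2 := Category.id_comp _

variable (R L) in
lemma push_theta (H : VFun V (Tambara R L) E) (x : M × A × N) :
    natApp ((cocone R L).push H).theta.hom x = H.mapHom (iota R L x.1 x.2.1 x.2.2) :=
  (H.mapHom_comp _ _).symm.trans (congrArg H.mapHom (cocone_theta R L x))

variable (R L) in
/-- The relative tensor product is the bicolimit of the truncated bar construction. -/
theorem cocone_isBicolimit : (cocone R L).IsBicolimit := by
  intro E _
  -- The relative tensor product has the objects of `M × N`, so the component at `C` already records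
  -- every component of a transformation.
  have faithful : ((cocone R L).pushFunctor E).Faithful :=
    ⟨fun {H K α β} h => nat_ext fun x =>
      congrArg (fun γ : (cocone R L).push H ⟶ (cocone R L).push K => natApp γ.hC x) h⟩
  have full : ((cocone R L).pushFunctor E).Full := ⟨fun {H K} f => by
    -- The components of `f.hC` are natural on morphisms of `M × N` by assumption and on `ι` because
    -- a morphism of cocones commutes with `θ`; these generate.
    refine ⟨VNatTrans.mk (fun x => natApp f.hC x) (natural (fun x y => ?_) fun m a n => ?_), ?_⟩
    · have k := f.hC.naturality x y
      exact (Category.assoc _ _ _).symm.trans (k.trans (Category.assoc _ _ _))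
    · have k := f.theta_comm (m, a, n)
      have p (H : VFun V (Tambara R L) E) :
          natApp (((cocone R L).pushFunctor E).obj H).theta.hom (m, a, n) =
            H.mapHom (iota R L m a n) := push_theta R L H (m, a, n)
      rw [p, p] at k
      exact k
    · exact BarCocone.Hom.ext_hC rfl⟩
  have essSurj : ((cocone R L).pushFunctor E).EssSurj := ⟨fun τ => by
    have hθ (m : M) (a b : A) (n : N) :=
      (bar_balanced_iff R L τ.sC τ.theta m a b n).1 (τ.theta_rel (m, a, b, n))
    -- The functor induced by `τ_C` and its `θ` restricts to `τ_C` with identity comparison and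
    -- sends `ι` to `θ`, which suffices for an isomorphism of cocones.
    refine ⟨lift τ.sC τ.theta hθ, ⟨BarCocone.isoOfC (inclLift τ.sC τ.theta hθ) fun x => ?_⟩⟩
    refine (Category.comp_id _).trans (Eq.trans ?_ (Category.id_comp _).symm)
    exact (push_theta R L _ x).trans (lift_iota τ.sC τ.theta hθ x.1 x.2.1 x.2.2)⟩
  exact { }

end Tambara
end TambaraLift
end VEnr

open VEnr
theorem theorem2p9 {V : Type v} [Category.{u} V] [MonoidalCategory V] [SymmetricCategory V]
    [MonoidalClosed V] [HasColimits V] {A M N : Type u} [EnrichedCategory V A]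
    [EnrichedCategory V M] [EnrichedCategory V N] (𝒜 : MonoidalVCat V A) (R : RightModule 𝒜 M)
    (L : LeftModule 𝒜 N) :
    (∃ σ : BarCocone (barDiagram R L) (Tambara R L), σ.IsBicolimit) ∧
      ∀ (P : Type u) [EnrichedCategory V P] (τ : BarCocone (barDiagram R L) P),
        τ.IsBicolimit → VEquivalent V (Tambara R L) P :=
  ⟨⟨Tambara.cocone R L, Tambara.cocone_isBicolimit R L⟩, fun _ _ _ hτ =>
    (Tambara.cocone_isBicolimit R L).vEquivalent hτ⟩
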